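/- **Setting.** Let $k$ be a field of characteristic $0$, let $V=V_{\bar 0}\oplus V_{\bar 1}$ be a $\mathbb{Z}/2$-graded $k$-vector space, and let $G$ be a finite subgroup of $GL(V)$ that respects the grading (both $V_{\bar 0}$ and $V_{\bar 1}$ are $G$-stable). For a $\mathbb{Z}/2$-graded vector space $U=U_{\bar 0}\oplus U_{\bar 1}$ let $$\operatorname{Sym}_\pm U=T(U)/I,\qquad \wedge_\pm U=T(U)/J,$$ where $I$ (resp. $J$) is the two-sided ideal of the tensor algebra $T(U)$ generated by all $a\otimes b-(-1)^{ij}\,b\otimes a$ (resp. $a\otimes b+(-1)^{ij}\,b\otimes a$) with $a\in U_{\bar i}$, $b\in U_{\bar j}$. The algebra $\operatorname{Sym}_\pm V$ is bigraded: $(\operatorname{Sym}_\pm V)_{ij}=\operatorname{Sym}^i(V_{\bar 0})\otimes\wedge^j(V_{\bar 1})$ is spanned by the products of $i$ elements of $V_{\bar 0}$ followed by $j$ elements of $V_{\bar 1}$. Put $$U=(\operatorname{Sym}_\pm V)^G=\bigoplus_{i,j}U_{ij},\qquad U_{ij}=(\operatorname{Sym}_\pm V)_{ij}^G,$$ which is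 $\mathbb{Z}/2$-graded by letting $U_{\bar 0}$ (resp. $U_{\bar 1}$) be the sum of the $U_{ij}$ with $j$ even (resp. odd). Then $\operatorname{Sym}_\pm U$ and $\wedge_\pm U$ are $\mathbb{Z}^3$-graded: degree $(n,i,j)$ is spanned by the products $u_1\cdots u_n$ with $u_l\in U_{p_lq_l}$, $\sum_l p_l=i$, $\sum_l q_l=j$. The space $V^n=V^{\oplus n}$ is $\mathbb{Z}/2$-graded by $V_{\bar 0}^n\oplus V_{\bar 1}^n$. The wreath product $\mathfrak{S}_n[G]=\mathfrak{S}_n\ltimes G^n$ acts on it by $(\sigma,g)(v)=(g_{\sigma^{-1}(1)}v_{\sigma^{-1}(1)},\dots,g_{\sigma^{-1}(n)}v_{\sigma^{-1}(n)})$, and hence acts on $\operatorname{Sym}_\pm V^n$ by algebra automorphisms; let $\operatorname{sgn}(\sigma,g)=\operatorname{sgn}(\sigma)$. Put $$R_G=\bigoplus_{n\ge 0}(\operatorname{Sym}_\pm V^n)^{\mathfrak{S}_n[G]},\qquad R_G^{\operatorname{sgn}}=\bigoplus_{n\ge 0}(\operatorname{Sym}_\pm V^n)^{\mathfrak{S}_n[G],\operatorname{sgn}},$$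 where $(\ )^{\mathfrak{S}_n[G],\operatorname{sgn}}$ consists of the $f$ with $w f=\operatorname{sgn}(w)f$ for all $w\in\mathfrak{S}_n[G]$. The components of degree $(n,i,j)$ are the intersections of the $n$-th summands with $(\operatorname{Sym}_\pm V^n)_{ij}$. For $A\in\operatorname{Sym}_\pm V^a$ and $B\in\operatorname{Sym}_\pm V^b$ let $\mu_{a,b}(A\otimes B)\in\operatorname{Sym}_\pm V^{a+b}$ be the product of the image of $A$ under the inclusion of $V^a$ as the first $a$ summands of $V^{a+b}$ and the image of $B$ under the inclusion of $V^b$ as the last $b$ summands. The shuffle product and the signed shuffle product are the bilinear extensions of $$A\otimes B\mapsto\sum_\tau \tau\bigl(\mu_{a,b}(A\otimes B)\bigr),\qquad A\otimes B\mapsto\sum_\tau \operatorname{sgn}(\tau)\,\tau\bigl(\mu_{a,b}(A\otimes B)\bigr),$$ where $\tau$ runs over the permutations in $\mathfrak{S}_{a+b}$ that are increasing on $\{1,\dots,a\}$ and on $\{a+1,\dots,a+b\}$, and $\tau$ carries the $l$-th summand of $V^{a+b}$ to the $\tau(l)$-th. **Theorem.** The shuffle product makes $R_G$, and the signed shuffle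 product makes $R_G^{\operatorname{sgn}}$, an associative unital $\mathbb{Z}^3$-graded $k$-algebra with unit $1\in k=\operatorname{Sym}_\pm V^0$. The algebras $\operatorname{Sym}_\pm U$ and $\wedge_\pm U$ are $\mathbb{Z}^3$-graded as above, and there are isomorphisms of $\mathbb{Z}^3$-graded algebras $$\operatorname{Sym}_\pm\bigl((\operatorname{Sym}_\pm V)^G\bigr)\cong R_G,\qquad \wedge_\pm\bigl((\operatorname{Sym}_\pm V)^G\bigr)\cong R_G^{\operatorname{sgn}}.$$ -/

import Mathlib

open scoped DirectSum

noncomputable section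

namespace SuperShuffle

section Super

variable {k V W : Type*} [Field k] [AddCommMonoid V] [Module k V] [AddCommMonoid W] [Module k W]

/-- The relations `a ⊗ b = ε (-1)^{ij} b ⊗ a` (for `a ∈ V_i`, `b ∈ V_j`, `i, j ∈ ℤ/2`) on the tensor
algebra of a `ℤ/2`-graded vector space `V = V_0 ⊕ V_1`. -/
inductive SuperRel (ε : ℤˣ) (𝒱 : ZMod 2 → Submodule k V) :
    TensorAlgebra k V → TensorAlgebra k V → Prop
  | swap (i j : ZMod 2) (a b : V) (ha : a ∈ 𝒱 i) (hb : b ∈ 𝒱 j) :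
      SuperRel ε 𝒱 (TensorAlgebra.ι k a * TensorAlgebra.ι k b)
        ((((ε : ℤ) : k) * (-1) ^ (i.val * j.val)) • (TensorAlgebra.ι k b * TensorAlgebra.ι k a))

/-- The quotient of the tensor algebra `T(V)` by the two-sided ideal generated by all
`a ⊗ b - ε (-1)^{ij} b ⊗ a` with `a ∈ V_i`, `b ∈ V_j`. It is the superpolynomial algebra `Sym_± V`
for `ε = 1` and the superexterior algebra `∧_± V` for `ε = -1`. -/
def SuperAlg (ε : ℤˣ) (𝒱 : ZMod 2 → Submodule k V) : Type _ :=
  (ringConGen (SuperRel ε 𝒱)).Quotient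

instance instRingSuperAlg (ε : ℤˣ) (𝒱 : ZMod 2 → Submodule k V) : Ring (SuperAlg ε 𝒱) :=
  inferInstanceAs <| Ring (RingCon.Quotient _)

instance instAlgebraSuperAlg (ε : ℤˣ) (𝒱 : ZMod 2 → Submodule k V) : Algebra k (SuperAlg ε 𝒱) :=
  inferInstanceAs <| Algebra k (RingCon.Quotient _)

/-- The quotient map `T(V) → Sym_± V` or `T(V) → ∧_± V`. -/
def quotMap (ε : ℤˣ) (𝒱 : ZMod 2 → Submodule k V) : TensorAlgebra k V →ₐ[k] SuperAlg ε 𝒱 :=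
  RingCon.mkₐ k (ringConGen (SuperRel ε 𝒱))

/-- The superpolynomial algebra `Sym_± V`. -/
abbrev SymPM (𝒱 : ZMod 2 → Submodule k V) : Type _ := SuperAlg 1 𝒱

/-- The canonical map from `V` to `Sym_± V` or `∧_± V`. -/
def gen (ε : ℤˣ) (𝒱 : ZMod 2 → Submodule k V) : V →ₗ[k] SuperAlg ε 𝒱 :=
  (quotMap ε 𝒱).toLinearMap ∘ₗ TensorAlgebra.ι k

theorem gen_swap (ε : ℤˣ) (𝒱 : ZMod 2 → Submodule k V) (i j : ZMod 2) (a b : V)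
    (ha : a ∈ 𝒱 i) (hb : b ∈ 𝒱 j) :
    gen ε 𝒱 a * gen ε 𝒱 b =
      (((ε : ℤ) : k) * (-1) ^ (i.val * j.val)) • (gen ε 𝒱 b * gen ε 𝒱 a) := by
  have h : quotMap ε 𝒱 _ = quotMap ε 𝒱 _ :=
    Quotient.sound (RingCon.le_ringConGen _ _ (SuperRel.swap (ε := ε) i j a b ha hb))
  simpa [gen] using h

/-- The algebra map induced by a linear map that respects the `ℤ/2`-gradings. -/
def superMap (ε : ℤˣ) {𝒱 : ZMod 2 → Submodule k V} {𝒲 : ZMod 2 → Submodule k W}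
    (f : V →ₗ[k] W) (hf : ∀ i, ∀ v ∈ 𝒱 i, f v ∈ 𝒲 i) : SuperAlg ε 𝒱 →ₐ[k] SuperAlg ε 𝒲 :=
  RingCon.liftₐ (ringConGen (SuperRel ε 𝒱)) (TensorAlgebra.lift k (gen ε 𝒲 ∘ₗ f)) <|
    RingCon.ringConGen_le.2 fun x y (h : SuperRel ε 𝒱 x y) => by
      change TensorAlgebra.lift k (gen ε 𝒲 ∘ₗ f) x = TensorAlgebra.lift k (gen ε 𝒲 ∘ₗ f) y
      obtain ⟨i, j, a, b, ha, hb⟩ := h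
      have h := gen_swap ε 𝒲 i j (f a) (f b) (hf i a ha) (hf j b hb)
      simpa using h

/-- The bihomogeneous component `(Sym_± V)_{ij} = Sym^i(V_0) ⊗ ∧^j(V_1)`: the span of all products
of `i` elements of `V_0` followed by `j` elements of `V_1`. -/
def bideg (𝒱 : ZMod 2 → Submodule k V) (i j : ℕ) : Submodule k (SymPM 𝒱) :=
  ((𝒱 0).map (gen 1 𝒱)) ^ i * ((𝒱 1).map (gen 1 𝒱)) ^ j

/-- If `V` carries, besides its `ℤ/2`-grading, a bigrading by subspaces `B i j`, then `Sym_± V` and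
`∧_± V` are trigraded: the component of degree `(n, i, j)` is spanned by the products of `n`
bihomogeneous elements of `V` whose bidegrees add up to `(i, j)`. -/
def tridegree (ε : ℤˣ) (𝒱 : ZMod 2 → Submodule k V) (B : ℕ → ℕ → Submodule k V)
    (d : ℕ × ℕ × ℕ) : Submodule k (SuperAlg ε 𝒱) :=
  Submodule.span k {x | ∃ (u : Fin d.1 → V) (p q : Fin d.1 → ℕ),
    (∀ l, u l ∈ B (p l) (q l)) ∧ ∑ l, p l = d.2.1 ∧ ∑ l, q l = d.2.2 ∧
      x = (List.ofFn fun l => gen ε 𝒱 (u l)).prod}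

end Super

section Invariants

variable {k V : Type*} [Field k] [AddCommGroup V] [Module k V]

/-- A group of linear automorphisms respects the `ℤ/2`-grading: `V_0` and `V_1` are `G`-stable. -/
def Respects (G : Subgroup (V ≃ₗ[k] V)) (𝒱 : ZMod 2 → Submodule k V) : Prop :=
  ∀ g ∈ G, ∀ i, ∀ v ∈ 𝒱 i, g v ∈ 𝒱 i

variable {𝒱 : ZMod 2 → Submodule k V} {G : Subgroup (V ≃ₗ[k] V)}

/-- The underlying vector space of the algebra `U = (Sym_± V)^G` of invariants. -/
def invariants (hG : Respects G 𝒱) : Submodule k (SymPM 𝒱) :=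
  ⨅ g : G, LinearMap.eqLocus
    (superMap 1 (g : V ≃ₗ[k] V).toLinearMap (hG g g.2)).toLinearMap LinearMap.id

/-- The bihomogeneous components `U_{ij} = (Sym_± V)_{ij}^G` of `U = (Sym_± V)^G`. -/
def invBideg (hG : Respects G 𝒱) (i j : ℕ) : Submodule k (invariants hG) :=
  (bideg 𝒱 i j).comap (invariants hG).subtype

/-- The `ℤ/2`-grading of `U = (Sym_± V)^G`: `U_0` (resp. `U_1`) is the sum of the `U_{ij}` with `j`
even (resp. odd). -/
def invParity (hG : Respects G 𝒱) (e : ZMod 2) : Submodule k (invariants hG) :=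
  ⨆ (i : ℕ) (j : ℕ) (_ : (j : ZMod 2) = e), invBideg hG i j

/-- The superpolynomial algebra `Sym_±((Sym_± V)^G)`. -/
abbrev SymInv (hG : Respects G 𝒱) : Type _ := SuperAlg 1 (invParity hG)

/-- The superexterior algebra `∧_±((Sym_± V)^G)`. -/
abbrev ExtInv (hG : Respects G 𝒱) : Type _ := SuperAlg (-1) (invParity hG)

/-- The trihomogeneous components of `Sym_±((Sym_± V)^G)`. -/
abbrev symTridegree (hG : Respects G 𝒱) : ℕ × ℕ × ℕ → Submodule k (SymInv hG) :=
  tridegree 1 (invParity hG) (invBideg hG)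

/-- The trihomogeneous components of `∧_±((Sym_± V)^G)`. -/
abbrev extTridegree (hG : Respects G 𝒱) : ℕ × ℕ × ℕ → Submodule k (ExtInv hG) :=
  tridegree (-1) (invParity hG) (invBideg hG)

/-- The `ℤ/2`-grading `V^n = V_0^n ⊕ V_1^n`. -/
def powGrading (𝒱 : ZMod 2 → Submodule k V) (n : ℕ) (i : ZMod 2) : Submodule k (Fin n → V) :=
  Submodule.pi Set.univ fun _ => 𝒱 i

/-- The algebra `Sym_± V^n`. -/
abbrev SymPow (𝒱 : ZMod 2 → Submodule k V) (n : ℕ) : Type _ := SymPM (powGrading 𝒱 n)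

/-- The action of the element `(σ, g)` of the wreath product `𝔖_n[G] = 𝔖_n ⋉ G^n` on `V^n`:
`(σ, g) v = (g_{σ⁻¹(1)} v_{σ⁻¹(1)}, …, g_{σ⁻¹(n)} v_{σ⁻¹(n)})`. -/
def wreathMap {n : ℕ} (σ : Equiv.Perm (Fin n)) (g : Fin n → G) : (Fin n → V) →ₗ[k] (Fin n → V) :=
  LinearMap.pi fun l =>
    (g (σ⁻¹ l) : V ≃ₗ[k] V).toLinearMap ∘ₗ LinearMap.proj (σ⁻¹ l)

theorem wreathMap_mem (hG : Respects G 𝒱) {n : ℕ} (σ : Equiv.Perm (Fin n)) (g : Fin n → G)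
    (i : ZMod 2) (v : Fin n → V) (hv : v ∈ powGrading 𝒱 n i) :
    wreathMap σ g v ∈ powGrading 𝒱 n i := by
  intro l _
  exact hG _ (g (σ⁻¹ l)).2 i _ (hv (σ⁻¹ l) trivial)

/-- The `χ`-relative invariants of `𝔖_n[G]` on `Sym_± V^n`, where the character `χ` of `𝔖_n` is
inflated to `𝔖_n[G]` by `χ(σ, g) = χ(σ)`. Trivial `χ` gives the invariants, `χ = sgn` the
antiinvariants. -/
def wreathInvariants (hG : Respects G 𝒱) (n : ℕ) (χ : Equiv.Perm (Fin n) →* ℤˣ) :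
    Submodule k (SymPow 𝒱 n) :=
  ⨅ (σ : Equiv.Perm (Fin n)) (g : Fin n → G), LinearMap.eqLocus
    (superMap 1 (wreathMap σ g) (wreathMap_mem hG σ g)).toLinearMap
    (((χ σ : ℤ) : k) • (LinearMap.id : SymPow 𝒱 n →ₗ[k] SymPow 𝒱 n))

end Invariants

section Shuffle

variable {k V : Type*} [Field k] [AddCommGroup V] [Module k V]

/-- The permutation `τ` acting on `V^n`; it carries the summand with index `l` identically to the
summand with index `τ l`. -/
def permMap {n : ℕ} (τ : Equiv.Perm (Fin n)) : (Fin n → V) →ₗ[k] (Fin n → V) :=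
  LinearMap.funLeft k V ⇑τ⁻¹

theorem permMap_mem (𝒱 : ZMod 2 → Submodule k V) {n : ℕ} (τ : Equiv.Perm (Fin n))
    (i : ZMod 2) (v : Fin n → V) (hv : v ∈ powGrading 𝒱 n i) :
    permMap (k := k) τ v ∈ powGrading 𝒱 n i :=
  fun l _ => hv (τ⁻¹ l) trivial

/-- The inclusion of `V^a` as the first `a` summands of `V^{a+b}`. -/
def inclLeft (k V : Type*) [Field k] [AddCommGroup V] [Module k V] (a b : ℕ) :
    (Fin a → V) →ₗ[k] (Fin (a + b) → V) where
  toFun v := Fin.append v 0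
  map_add' v w := by
    ext l
    refine Fin.addCases (fun i => ?_) (fun i => ?_) l <;> simp
  map_smul' c v := by
    ext l
    refine Fin.addCases (fun i => ?_) (fun i => ?_) l <;> simp

/-- The inclusion of `V^b` as the last `b` summands of `V^{a+b}`. -/
def inclRight (k V : Type*) [Field k] [AddCommGroup V] [Module k V] (a b : ℕ) :
    (Fin b → V) →ₗ[k] (Fin (a + b) → V) where
  toFun v := Fin.append 0 v
  map_add' v w := by
    ext l
    refine Fin.addCases (fun i => ?_) (fun i => ?_) l <;> simp
  map_smul' c v := by
    ext l
    refine Fin.addCases (fun i => ?_) (fun i => ?_) l <;> simp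

theorem inclLeft_mem (𝒱 : ZMod 2 → Submodule k V) (a b : ℕ) (i : ZMod 2) (v : Fin a → V)
    (hv : v ∈ powGrading 𝒱 a i) : inclLeft k V a b v ∈ powGrading 𝒱 (a + b) i := by
  intro l _
  refine Fin.addCases (fun m => ?_) (fun m => ?_) l
  · simpa [inclLeft] using hv m trivial
  · simp [inclLeft]

theorem inclRight_mem (𝒱 : ZMod 2 → Submodule k V) (a b : ℕ) (i : ZMod 2) (v : Fin b → V)
    (hv : v ∈ powGrading 𝒱 b i) : inclRight k V a b v ∈ powGrading 𝒱 (a + b) i := by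
  intro l _
  refine Fin.addCases (fun m => ?_) (fun m => ?_) l
  · simp [inclRight]
  · simpa [inclRight] using hv m trivial

/-- `μ_{a,b} : Sym_± V^a ⊗ Sym_± V^b → Sym_± V^{a+b}`: include both factors in `Sym_± V^{a+b}` and
multiply there. -/
def mu (𝒱 : ZMod 2 → Submodule k V) (a b : ℕ) :
    SymPow 𝒱 a →ₗ[k] SymPow 𝒱 b →ₗ[k] SymPow 𝒱 (a + b) :=
  (LinearMap.mul k (SymPow 𝒱 (a + b))).compl₁₂
    (superMap 1 (inclLeft k V a b) (inclLeft_mem 𝒱 a b)).toLinearMap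
    (superMap 1 (inclRight k V a b) (inclRight_mem 𝒱 a b)).toLinearMap

/-- The `(a, b)`-shuffles, recorded by where they send the indices of the variables: the permutations
`τ` that are increasing on the block of the first `a` and on the block of the last `b` indices.
These are the minimum-length representatives of the cosets of the Young subgroup `𝔖_a × 𝔖_b`. -/
def shuffles (a b : ℕ) : Finset (Equiv.Perm (Fin (a + b))) :=
  Finset.univ.filter fun τ =>
    (∀ i j : Fin a, i < j → τ (Fin.castAdd b i) < τ (Fin.castAdd b j)) ∧
    (∀ i j : Fin b, i < j → τ (Fin.natAdd a i) < τ (Fin.natAdd a j))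

/-- The product `Sym_± V^a ⊗ Sym_± V^b → Sym_± V^{a+b}` given by
`A ⊗ B ↦ ∑_τ χ(τ) τ(μ_{a,b}(A ⊗ B))`, summed over all `(a, b)`-shuffles `τ`. Trivial `χ` gives the
shuffle product, `χ = sgn` the signed shuffle product. -/
def shuffle (𝒱 : ZMod 2 → Submodule k V) (χ : (n : ℕ) → Equiv.Perm (Fin n) →* ℤˣ) (a b : ℕ) :
    SymPow 𝒱 a →ₗ[k] SymPow 𝒱 b →ₗ[k] SymPow 𝒱 (a + b) :=
  ∑ τ ∈ shuffles a b, ((χ (a + b) τ : ℤ) : k) •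
    (mu 𝒱 a b).compr₂ (superMap 1 (permMap τ) (permMap_mem 𝒱 τ)).toLinearMap

/-- The direct sum of all `Sym_± V^n`, `n = 0, 1, 2, …`. -/
abbrev Total (𝒱 : ZMod 2 → Submodule k V) : Type _ := ⨁ n : ℕ, SymPow 𝒱 n

/-- The bilinear extension of the products `shuffle 𝒱 χ a b` to the direct sum. -/
def shuffleMul (𝒱 : ZMod 2 → Submodule k V) (χ : (n : ℕ) → Equiv.Perm (Fin n) →* ℤˣ) :
    Total 𝒱 →ₗ[k] Total 𝒱 →ₗ[k] Total 𝒱 :=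
  DirectSum.toModule k ℕ _ fun a => LinearMap.flip <|
    DirectSum.toModule k ℕ _ fun b => LinearMap.flip <|
      (shuffle 𝒱 χ a b).compr₂ (DirectSum.lof k ℕ (fun n => SymPow 𝒱 n) (a + b))

/-- The element `1 ∈ k = Sym_± V^0` of the direct sum. -/
def totalOne (𝒱 : ZMod 2 → Submodule k V) : Total 𝒱 :=
  DirectSum.lof k ℕ (fun n => SymPow 𝒱 n) 0 1

variable {𝒱 : ZMod 2 → Submodule k V} {G : Subgroup (V ≃ₗ[k] V)}

/-- `⨁_n (Sym_± V^n)^{𝔖_n[G], χ}`, as a subspace of `⨁_n Sym_± V^n`. -/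
def wreathSum (hG : Respects G 𝒱) (χ : (n : ℕ) → Equiv.Perm (Fin n) →* ℤˣ) :
    Submodule k (Total 𝒱) :=
  ⨆ n : ℕ, (wreathInvariants hG n (χ n)).map (DirectSum.lof k ℕ (fun n => SymPow 𝒱 n) n)

/-- The trihomogeneous component `(Sym_± V^n)_{ij}^{𝔖_n[G], χ}` of degree `(n, i, j)`. -/
def wreathTridegree (hG : Respects G 𝒱) (χ : (n : ℕ) → Equiv.Perm (Fin n) →* ℤˣ)
    (d : ℕ × ℕ × ℕ) : Submodule k (Total 𝒱) :=
  (wreathInvariants hG d.1 (χ d.1) ⊓ bideg (powGrading 𝒱 d.1) d.2.1 d.2.2).map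
    (DirectSum.lof k ℕ (fun n => SymPow 𝒱 n) d.1)

/-- The trivial character of every symmetric group. -/
def trivChar (n : ℕ) : Equiv.Perm (Fin n) →* ℤˣ := 1

/-- The sign character of every symmetric group. -/
def signChar (n : ℕ) : Equiv.Perm (Fin n) →* ℤˣ := Equiv.Perm.sign

/-- `R_G = ⨁_n (Sym_± V^n)^{𝔖_n[G]}`. -/
abbrev RG (hG : Respects G 𝒱) : Submodule k (Total 𝒱) := wreathSum hG trivChar

/-- `R_G^sgn = ⨁_n (Sym_± V^n)^{𝔖_n[G], sgn}`. -/
abbrev RGsgn (hG : Respects G 𝒱) : Submodule k (Total 𝒱) := wreathSum hG signChar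

end Shuffle

section Graded

variable {k A T : Type*} [Field k] [AddCommGroup A] [Module k A] [AddCommGroup T] [Module k T]

/-- The subspace `R` with the product `mul` and the unit `one` is an associative unital algebra,
and the subspaces `gr d` form a grading of it by `ℕ³` (hence by `ℤ³`). -/
structure IsTrigradedAlgebra (mul : T →ₗ[k] T →ₗ[k] T) (one : T) (R : Submodule k T)
    (gr : ℕ × ℕ × ℕ → Submodule k T) : Prop where
  mul_mem : ∀ x ∈ R, ∀ y ∈ R, mul x y ∈ R
  one_mem : one ∈ R
  mul_assoc : ∀ x ∈ R, ∀ y ∈ R, ∀ z ∈ R, mul (mul x y) z = mul x (mul y z)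
  one_mul : ∀ x ∈ R, mul one x = x
  mul_one : ∀ x ∈ R, mul x one = x
  indep : iSupIndep gr
  iSup_eq : ⨆ d, gr d = R
  one_mem_gr : one ∈ gr 0
  mul_mem_gr : ∀ d e, ∀ x ∈ gr d, ∀ y ∈ gr e, mul x y ∈ gr (d + e)

/-- The linear isomorphism `φ : A ≃ R` is an isomorphism of trigraded algebras. -/
structure IsTrigradedIso (mulA : A →ₗ[k] A →ₗ[k] A) (oneA : A) (grA : ℕ × ℕ × ℕ → Submodule k A)
    (mul : T →ₗ[k] T →ₗ[k] T) (one : T) (R : Submodule k T) (gr : ℕ × ℕ × ℕ → Submodule k T)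
    (φ : A ≃ₗ[k] R) : Prop where
  map_one : (φ oneA : T) = one
  map_mul : ∀ x y, (φ (mulA x y) : T) = mul (φ x) (φ y)
  map_gr : ∀ d, (grA d).map (R.subtype ∘ₗ φ.toLinearMap) = gr d

end Graded

end SuperShuffle

end

open SuperShuffle

/-!
Write `U = (Sym_± V)^G` and let `f^{(l)}` be the image of `f` in `Sym_± V^n` under the inclusion
of the `l`-th summand. Both isomorphisms are induced by one construction, for a sign `ε` and a
family `χ` of characters of the symmetric groups that is multiplicative on Young subgroups and
takes the value `ε` on adjacent transpositions: a pure tensor goes to a symmetrized product,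
`u_1 ⊗ ⋯ ⊗ u_n ↦ ∑_σ χ(σ) σ(u_1^{(1)} ⋯ u_n^{(n)})` (`tensorPhi`).

* The map `f_1 ⊗ ⋯ ⊗ f_n ↦ f_1^{(1)} ⋯ f_n^{(n)}` from `(Sym_± V)^{⊗ n}` to `Sym_± V^n` is
  bijective (`tensorMap_injective`, `tensorMap_surjective`). For injectivity, `Sym_± V^n` is made
  to act on the tensor power, an odd variable acquiring the Koszul sign by applying the parity
  automorphism to all tensor factors in front of its own; acting on `1 ⊗ ⋯ ⊗ 1` recovers the
  tensor.
* Averaging over `G` in each factor shows that the `G^n`-invariants correspond to `U^{⊗ n}`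
  (`invMap_injective`, `exists_invMap_eq`). As `n!` is invertible, symmetrization then maps
  `U^{⊗ n}` onto the `χ`-relative invariants of the wreath product.
* On `U^{⊗ n}` an adjacent transposition of the variables becomes the exchange of two factors with
  the Koszul sign, and after the twist by `χ` this is a defining relation of `Sym_± U` (`ε = 1`)
  or `∧_± U` (`ε = -1`). So symmetrization factors through this quotient
  (`tensorPhi_eq_of_quotMap_eq`), and its kernel is no larger (`tensorQuot_eq_zero`).
* Shuffles represent the cosets of `𝔖_a × 𝔖_b` in `𝔖_{a+b}`, so the shuffle product of two
  symmetrized elements is the symmetrization of their concatenation (`shuffle_symmetrize`). Hence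
  `tensorPhi` is multiplicative, and associativity of the shuffle product on its range is
  inherited from `T(U)`.
* The bigrading of `Sym_± W` is independent because `W_0 ↦ s W_0`, `W_1 ↦ t W_1` extends to an
  algebra map to `Sym_± W [s, t]`. As symmetrization preserves degrees, the grading of the source
  and the equality of components follow (`trigraded_of_injective`).
-/

open scoped DirectSum

noncomputable section

namespace SuperShuffle

/-! ### Universal property, commutation up to sign, and the bigrading -/

section Universal

variable {k V W X A : Type*} [Field k] [AddCommMonoid V] [Module k V] [AddCommMonoid W] [Module k W]
  [AddCommMonoid X] [Module k X] [Ring A] [Algebra k A]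
  {ε : ℤˣ} {𝒱 : ZMod 2 → Submodule k V} {𝒲 : ZMod 2 → Submodule k W} {𝒳 : ZMod 2 → Submodule k X}

theorem quotMap_surjective (ε : ℤˣ) (𝒱 : ZMod 2 → Submodule k V) :
    Function.Surjective (quotMap ε 𝒱) :=
  RingCon.mkₐ_surjective _

@[simp] theorem quotMap_ι (v : V) : quotMap ε 𝒱 (TensorAlgebra.ι k v) = gen ε 𝒱 v := rfl

theorem SuperAlg.induction {C : SuperAlg ε 𝒱 → Prop}
    (algebraMap : ∀ r : k, C (algebraMap k _ r)) (gen : ∀ v, C (gen ε 𝒱 v))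
    (mul : ∀ a b, C a → C b → C (a * b)) (add : ∀ a b, C a → C b → C (a + b))
    (x : SuperAlg ε 𝒱) : C x := by
  obtain ⟨x, rfl⟩ := quotMap_surjective ε 𝒱 x
  induction x using TensorAlgebra.induction with
  | algebraMap r => simpa using algebraMap r
  | ι v => exact gen v
  | mul a b ha hb => simpa using mul _ _ ha hb
  | add a b ha hb => simpa using add _ _ ha hb

/-- The universal property of `Sym_± V` and `∧_± V`: a linear map to an algebra whose values satisfy
the defining (anti)commutation relations extends to an algebra map. -/
def SuperAlg.lift (f : V →ₗ[k] A)
    (hf : ∀ i j, ∀ a ∈ 𝒱 i, ∀ b ∈ 𝒱 j,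
      f a * f b = (((ε : ℤ) : k) * (-1) ^ (i.val * j.val)) • (f b * f a)) :
    SuperAlg ε 𝒱 →ₐ[k] A :=
  RingCon.liftₐ (ringConGen (SuperRel ε 𝒱)) (TensorAlgebra.lift k f) <|
    RingCon.ringConGen_le.2 fun x y (h : SuperRel ε 𝒱 x y) => by
      change TensorAlgebra.lift k f x = TensorAlgebra.lift k f y
      obtain ⟨i, j, a, b, ha, hb⟩ := h
      simpa using hf i j a ha b hb

@[simp] theorem SuperAlg.lift_gen (f : V →ₗ[k] A) (hf) (v : V) :
    SuperAlg.lift (ε := ε) (𝒱 := 𝒱) f hf (gen ε 𝒱 v) = f v :=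
  TensorAlgebra.lift_ι_apply f v

@[simp] theorem superMap_gen (f : V →ₗ[k] W) (hf : ∀ i, ∀ v ∈ 𝒱 i, f v ∈ 𝒲 i) (v : V) :
    superMap ε f hf (gen ε 𝒱 v) = gen ε 𝒲 (f v) :=
  TensorAlgebra.lift_ι_apply (gen ε 𝒲 ∘ₗ f) v

theorem SuperAlg.algHom_ext {f g : SuperAlg ε 𝒱 →ₐ[k] A}
    (h : ∀ v, f (gen ε 𝒱 v) = g (gen ε 𝒱 v)) : f = g := by
  ext x
  induction x using SuperAlg.induction with
  | algebraMap r => simp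
  | gen v => exact h v
  | mul a b ha hb => simp [ha, hb]
  | add a b ha hb => simp [ha, hb]

theorem superMap_superMap (g : W →ₗ[k] X) (hg : ∀ i, ∀ v ∈ 𝒲 i, g v ∈ 𝒳 i)
    (f : V →ₗ[k] W) (hf : ∀ i, ∀ v ∈ 𝒱 i, f v ∈ 𝒲 i) (h : V →ₗ[k] X)
    (hh : ∀ i, ∀ v ∈ 𝒱 i, h v ∈ 𝒳 i) (hc : ∀ v, g (f v) = h v) (x : SuperAlg ε 𝒱) :
    superMap ε g hg (superMap ε f hf x) = superMap ε h hh x := by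
  have : (superMap ε g hg).comp (superMap ε f hf) = superMap ε h hh :=
    SuperAlg.algHom_ext fun v => by simp [hc]
  exact DFunLike.congr_fun this x

theorem superMap_eq_self (f : V →ₗ[k] V) (hf : ∀ i, ∀ v ∈ 𝒱 i, f v ∈ 𝒱 i)
    (h : ∀ v, f v = v) (x : SuperAlg ε 𝒱) : superMap ε f hf x = x := by
  have : superMap ε f hf = AlgHom.id k _ := SuperAlg.algHom_ext fun v => by simp [h]
  exact DFunLike.congr_fun this x

end Universal

section SuperCommute

variable {k A : Type*} [Field k] [Ring A] [Algebra k A]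

/-- The subspaces `M` and `N` of an algebra commute up to the sign `(-1)^n`. -/
def SuperCommute (n : ℕ) (M N : Submodule k A) : Prop :=
  ∀ a ∈ M, ∀ b ∈ N, a * b = (-1 : k) ^ n • (b * a)

namespace SuperCommute

variable {m n : ℕ} {M M' N : Submodule k A}

theorem symm (h : SuperCommute n M N) : SuperCommute n N M := fun a ha b hb => by
  rw [h b hb a ha, smul_smul, ← mul_pow]
  simp

theorem one_left : SuperCommute 0 1 N := fun a ha b _ => by
  obtain ⟨r, rfl⟩ := Submodule.mem_one.1 ha
  simp [Algebra.commutes]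

theorem mul_left (h : SuperCommute m M N) (h' : SuperCommute n M' N) :
    SuperCommute (m + n) (M * M') N := fun a ha b hb => by
  induction ha using Submodule.mul_induction_on' with
  | mem_mul_mem x hx y hy =>
    rw [mul_assoc, h' y hy b hb, mul_smul_comm, ← mul_assoc, h x hx b hb, smul_mul_assoc, smul_smul,
      mul_assoc, pow_add, mul_comm]
  | add x _ y _ hx hy => rw [add_mul, hx, hy, mul_add, smul_add]

theorem pow_left (h : SuperCommute m M N) (i : ℕ) : SuperCommute (i * m) (M ^ i) N := by
  induction i with
  | zero => simpa using one_left
  | succ i ih => simpa [pow_succ, add_mul] using ih.mul_left h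

theorem mul_right {N' : Submodule k A} (h : SuperCommute m M N) (h' : SuperCommute n M N') :
    SuperCommute (m + n) M (N * N') :=
  (h.symm.mul_left h'.symm).symm

theorem pow_right (h : SuperCommute m M N) (i : ℕ) : SuperCommute (i * m) M (N ^ i) :=
  (h.symm.pow_left i).symm

theorem mul_comm (h : SuperCommute n M N) : M * N = N * M := by
  have key : ∀ {M N : Submodule k A}, SuperCommute n M N → M * N ≤ N * M := fun h =>
    Submodule.mul_le.2 fun a ha b hb => by
      rw [h a ha b hb]
      exact Submodule.smul_mem _ _ (Submodule.mul_mem_mul hb ha)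
  exact le_antisymm (key h) (key h.symm)

end SuperCommute

end SuperCommute

section Bidegree

variable {k V W : Type*} [Field k] [AddCommMonoid V] [Module k V] [AddCommMonoid W] [Module k W]
  (𝒱 : ZMod 2 → Submodule k V) {𝒲 : ZMod 2 → Submodule k W}

theorem superCommute_gen (i j : ZMod 2) :
    SuperCommute (i.val * j.val) ((𝒱 i).map (gen 1 𝒱)) ((𝒱 j).map (gen 1 𝒱)) := by
  rintro _ ⟨a, ha, rfl⟩ _ ⟨b, hb, rfl⟩
  simpa using gen_swap 1 𝒱 i j a b ha hb

theorem superCommute_bideg (i j i' j' : ℕ) :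
    SuperCommute (j * j') (bideg 𝒱 i j) (bideg 𝒱 i' j') := by
  have h (e f : ZMod 2) (a b : ℕ) := ((superCommute_gen 𝒱 e f).pow_left a).pow_right b
  have := ((h 0 0 i i').mul_right (h 0 1 i j')).mul_left ((h 1 0 j i').mul_right (h 1 1 j j'))
  simpa [bideg, ZMod.val_one, mul_comm] using this

theorem bideg_mul (i j i' j' : ℕ) :
    bideg 𝒱 i j * bideg 𝒱 i' j' = bideg 𝒱 (i + i') (j + j') := by
  have h := (((superCommute_gen 𝒱 1 0).pow_left j).pow_right i').mul_comm
  simp only [bideg] at *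
  rw [mul_assoc, ← mul_assoc (Submodule.map _ _ ^ j), h, pow_add, pow_add]
  simp only [mul_assoc]

theorem bideg_zero : bideg 𝒱 0 0 = 1 := by simp [bideg]

theorem one_mem_bideg : (1 : SymPM 𝒱) ∈ bideg 𝒱 0 0 := by
  rw [bideg_zero]
  exact Submodule.one_le.1 le_rfl

theorem gen_mem_bideg_zero {v : V} (hv : v ∈ 𝒱 0) : gen 1 𝒱 v ∈ bideg 𝒱 1 0 := by
  simpa [bideg] using ⟨v, hv, rfl⟩

theorem gen_mem_bideg_one {v : V} (hv : v ∈ 𝒱 1) : gen 1 𝒱 v ∈ bideg 𝒱 0 1 := by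
  simpa [bideg] using ⟨v, hv, rfl⟩

variable {𝒱}

theorem superMap_mem_bideg (f : V →ₗ[k] W) (hf : ∀ i, ∀ v ∈ 𝒱 i, f v ∈ 𝒲 i) {i j : ℕ}
    {x : SymPM 𝒱} (hx : x ∈ bideg 𝒱 i j) : superMap 1 f hf x ∈ bideg 𝒲 i j := by
  have key (e : ZMod 2) : ((𝒱 e).map (gen 1 𝒱)).map (superMap 1 f hf).toLinearMap ≤
      (𝒲 e).map (gen 1 𝒲) := by
    rintro _ ⟨_, ⟨v, hv, rfl⟩, rfl⟩
    exact ⟨f v, hf e v hv, (superMap_gen f hf v).symm⟩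
  have : (bideg 𝒱 i j).map (superMap 1 f hf).toLinearMap ≤ bideg 𝒲 i j := by
    rw [bideg, Submodule.map_mul, Submodule.map_pow, Submodule.map_pow]
    exact mul_le_mul' (pow_le_pow_left' (key 0) i) (pow_le_pow_left' (key 1) j)
  exact this ⟨x, hx, rfl⟩

theorem iSup_bideg (h : ⨆ i, 𝒱 i = ⊤) : ⨆ d : ℕ × ℕ, bideg 𝒱 d.1 d.2 = ⊤ := by
  set S := ⨆ d : ℕ × ℕ, bideg 𝒱 d.1 d.2 with hS
  have hle (i j : ℕ) : bideg 𝒱 i j ≤ S := le_iSup (fun d : ℕ × ℕ => bideg 𝒱 d.1 d.2) (i, j)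
  have hmul : S * S ≤ S := by
    rw [hS, Submodule.iSup_mul]
    refine iSup_le fun d => ?_
    rw [Submodule.mul_iSup]
    refine iSup_le fun e => ?_
    rw [bideg_mul]
    exact hle _ _
  have hgen (v : V) : gen 1 𝒱 v ∈ S := by
    have hv : v ∈ ⨆ i, 𝒱 i := h ▸ Submodule.mem_top
    have : ⨆ i, 𝒱 i ≤ S.comap (gen 1 𝒱) := iSup_le fun i v hv => by
      fin_cases i
      · exact hle _ _ (gen_mem_bideg_zero 𝒱 hv)
      · exact hle _ _ (gen_mem_bideg_one 𝒱 hv)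
    exact this hv
  refine eq_top_iff.2 fun x _ => ?_
  induction x using SuperAlg.induction with
  | algebraMap r =>
    rw [Algebra.algebraMap_eq_smul_one]
    exact S.smul_mem r (hle _ _ (one_mem_bideg 𝒱))
  | gen v => exact hgen v
  | mul a b ha hb => exact hmul (Submodule.mul_mem_mul (ha trivial) (hb trivial))
  | add a b ha hb => exact S.add_mem (ha trivial) (hb trivial)

end Bidegree

section Projections

/-- A family of subspaces is independent if each member `p d` is fixed pointwise by a linear map
that kills all the others. -/
theorem iSupIndep_of_projections {k M ι : Type*} [Field k] [AddCommGroup M] [Module k M]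
    (p : ι → Submodule k M) (π : ι → M →ₗ[k] M) (h : ∀ d, ∀ x ∈ p d, π d x = x)
    (h' : ∀ d e, e ≠ d → ∀ x ∈ p e, π d x = 0) : iSupIndep p := by
  intro d
  rw [Submodule.disjoint_def]
  intro x hx hx'
  have : ⨆ (e) (_ : e ≠ d), p e ≤ LinearMap.ker (π d) :=
    iSup₂_le fun e he x hx => h' d e he x hx
  rw [← h d x hx]
  exact this hx'

variable {k V : Type*} [Field k] [AddCommGroup V] [Module k V] {𝒱 : ZMod 2 → Submodule k V}

/-- The projection of `V = V_0 ⊕ V_1` to `V_e`, as an endomorphism of `V`. -/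
def proj (h𝒱 : DirectSum.IsInternal 𝒱) (e : ZMod 2) : V →ₗ[k] V :=
  letI := h𝒱.chooseDecomposition
  (𝒱 e).subtype ∘ₗ DirectSum.component k (ZMod 2) (fun i => 𝒱 i) e ∘ₗ
    (DirectSum.decomposeLinearEquiv 𝒱).toLinearMap

variable (h𝒱 : DirectSum.IsInternal 𝒱)

theorem proj_mem (e : ZMod 2) (v : V) : proj h𝒱 e v ∈ 𝒱 e := by simp [proj]

theorem proj_of_mem {e : ZMod 2} {v : V} (hv : v ∈ 𝒱 e) (f : ZMod 2) :
    proj h𝒱 f v = if f = e then v else 0 := by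
  let _ := h𝒱.chooseDecomposition
  change ((DirectSum.decompose 𝒱 v f : 𝒱 f) : V) = _
  split_ifs with h
  · exact DirectSum.decompose_of_mem_same 𝒱 (h ▸ hv)
  · exact DirectSum.decompose_of_mem_ne 𝒱 hv (Ne.symm h)

theorem sum_proj (v : V) : ∑ e, proj h𝒱 e v = v := by
  have hv : v ∈ ⨆ i, 𝒱 i := h𝒱.submodule_iSup_eq_top ▸ Submodule.mem_top
  have : ⨆ i, 𝒱 i ≤ LinearMap.eqLocus (∑ e, proj h𝒱 e) LinearMap.id := iSup_le fun i v hv => by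
    simp [proj_of_mem h𝒱 hv]
  simpa using this hv

/-- The algebra map `Sym_± V → Sym_± V [s, t]` that multiplies `V_0` by `s` and `V_1` by `t`; it
multiplies the component of bidegree `(i, j)` by `s^i t^j`. -/
def bidegMap : SymPM 𝒱 →ₐ[k] AddMonoidAlgebra (SymPM 𝒱) (ℕ × ℕ) :=
  SuperAlg.lift (∑ e : ZMod 2, AddMonoidAlgebra.lsingle (if e = 0 then (1, 0) else (0, 1)) ∘ₗ
    gen 1 𝒱 ∘ₗ proj h𝒱 e) fun i j a ha b hb => by
      have key {e : ZMod 2} {v : V} (hv : v ∈ 𝒱 e) :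
          (∑ e : ZMod 2, AddMonoidAlgebra.lsingle (if e = 0 then (1, 0) else (0, 1)) ∘ₗ
            gen 1 𝒱 ∘ₗ proj h𝒱 e) v =
          AddMonoidAlgebra.single (if e = 0 then ((1, 0) : ℕ × ℕ) else (0, 1)) (gen 1 𝒱 v) := by
        simp only [LinearMap.sum_apply, LinearMap.comp_apply, proj_of_mem h𝒱 hv]
        rw [Finset.sum_eq_single e] <;> simp +contextual
      rw [key ha, key hb, AddMonoidAlgebra.single_mul_single, AddMonoidAlgebra.single_mul_single,
        gen_swap 1 𝒱 i j a b ha hb, add_comm, AddMonoidAlgebra.smul_single]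

theorem bidegMap_gen {e : ZMod 2} {v : V} (hv : v ∈ 𝒱 e) :
    bidegMap h𝒱 (gen 1 𝒱 v) =
      AddMonoidAlgebra.single (if e = 0 then ((1, 0) : ℕ × ℕ) else (0, 1)) (gen 1 𝒱 v) := by
  simp only [bidegMap, SuperAlg.lift_gen, LinearMap.sum_apply, LinearMap.comp_apply,
    proj_of_mem h𝒱 hv]
  rw [Finset.sum_eq_single e] <;> simp +contextual

theorem bidegMap_of_mem {i j : ℕ} {x : SymPM 𝒱} (hx : x ∈ bideg 𝒱 i j) :
    bidegMap h𝒱 x = AddMonoidAlgebra.single (i, j) x := by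
  let H (d : ℕ × ℕ) : Submodule k (SymPM 𝒱) :=
    LinearMap.eqLocus (bidegMap h𝒱).toLinearMap (AddMonoidAlgebra.lsingle d)
  have hone : (1 : Submodule k (SymPM 𝒱)) ≤ H 0 := by
    rw [Submodule.one_le]
    simp [H, AddMonoidAlgebra.one_def]
  have hmul (d e : ℕ × ℕ) : H d * H e ≤ H (d + e) := Submodule.mul_le.2 fun x hx y hy => by
    simp only [H, LinearMap.mem_eqLocus, AlgHom.toLinearMap_apply,
      AddMonoidAlgebra.lsingle_apply] at hx hy ⊢
    rw [map_mul, hx, hy, AddMonoidAlgebra.single_mul_single]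
  have hpow {d : ℕ × ℕ} {M : Submodule k (SymPM 𝒱)} (h : M ≤ H d) (n : ℕ) : M ^ n ≤ H (n • d) := by
    induction n with
    | zero => simpa using hone
    | succ n ih =>
      rw [pow_succ, succ_nsmul]
      exact (mul_le_mul' ih h).trans (hmul _ _)
  have hgen (e : ZMod 2) : (𝒱 e).map (gen 1 𝒱) ≤ H (if e = 0 then (1, 0) else (0, 1)) := by
    rintro _ ⟨v, hv, rfl⟩
    exact bidegMap_gen h𝒱 hv
  have := (mul_le_mul' (hpow (hgen 0) i) (hpow (hgen 1) j)).trans (hmul _ _) hx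
  simpa [H] using this

/-- The projection of `Sym_± V` to the component of bidegree `d`. -/
def bidegProj (d : ℕ × ℕ) : SymPM 𝒱 →ₗ[k] SymPM 𝒱 where
  toFun x := (bidegMap h𝒱 x).coeff d
  map_add' x y := by simp
  map_smul' c x := by simp

theorem bidegProj_of_mem (d : ℕ × ℕ) {i j : ℕ} {x : SymPM 𝒱} (hx : x ∈ bideg 𝒱 i j) :
    bidegProj h𝒱 d x = if (i, j) = d then x else 0 := by
  simp [bidegProj, bidegMap_of_mem h𝒱 hx, AddMonoidAlgebra.coeff_single, Finsupp.single_apply]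

end Projections

section Parity

variable {k V W : Type*} [Field k] [AddCommGroup V] [Module k V] {𝒱 : ZMod 2 → Submodule k V}
  (h𝒱 : DirectSum.IsInternal 𝒱)

theorem zmod_two_cases : ∀ e : ZMod 2, e = 0 ∨ e = 1 := by decide

theorem signMap_mem (i : ZMod 2) (v : V) (hv : v ∈ 𝒱 i) :
    (proj h𝒱 0 - proj h𝒱 1) v ∈ 𝒱 i := by
  simp only [LinearMap.sub_apply, proj_of_mem h𝒱 hv]
  obtain rfl | rfl := zmod_two_cases i <;> simpa using hv

/-- The parity automorphism of `Sym_± V`, which is `1` on `V_0` and `-1` on `V_1`. -/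
def parity : SymPM 𝒱 →ₐ[k] SymPM 𝒱 := superMap 1 (proj h𝒱 0 - proj h𝒱 1) (signMap_mem h𝒱)

theorem parity_gen {e : ZMod 2} {v : V} (hv : v ∈ 𝒱 e) :
    parity h𝒱 (gen 1 𝒱 v) = (-1 : k) ^ e.val • gen 1 𝒱 v := by
  simp only [parity, superMap_gen, LinearMap.sub_apply, proj_of_mem h𝒱 hv]
  obtain rfl | rfl := zmod_two_cases e <;> simp [ZMod.val_one]

/-- The power `P^f` of the parity automorphism `P`, as a linear map. -/
def parityPow (f : ZMod 2) : SymPM 𝒱 →ₗ[k] SymPM 𝒱 := (parity h𝒱).toLinearMap ^ f.val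

@[simp] theorem parityPow_one (f : ZMod 2) : parityPow h𝒱 f 1 = 1 := by
  obtain rfl | rfl := zmod_two_cases f <;> simp [parityPow, ZMod.val_one]

theorem parityPow_mul (f : ZMod 2) (x y : SymPM 𝒱) :
    parityPow h𝒱 f (x * y) = parityPow h𝒱 f x * parityPow h𝒱 f y := by
  obtain rfl | rfl := zmod_two_cases f <;> simp [parityPow, ZMod.val_one]

theorem parityPow_gen {e : ZMod 2} {v : V} (hv : v ∈ 𝒱 e) (f : ZMod 2) :
    parityPow h𝒱 f (gen 1 𝒱 v) = (-1 : k) ^ (f.val * e.val) • gen 1 𝒱 v := by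
  obtain rfl | rfl := zmod_two_cases f <;> simp [parityPow, ZMod.val_one, parity_gen h𝒱 hv]

end Parity

/-! ### The isomorphism `(Sym_± V)^{⊗ n} ≅ Sym_± V^n` -/

section TensorPower

open scoped TensorProduct
open PiTensorProduct

variable {k V : Type*} [Field k] [AddCommGroup V] [Module k V] (𝒱 : ZMod 2 → Submodule k V)

theorem single_mem {n : ℕ} (l : Fin n) (i : ZMod 2) (v : V) (hv : v ∈ 𝒱 i) :
    (Pi.single l v : Fin n → V) ∈ powGrading 𝒱 n i := by
  intro m _
  by_cases h : m = l
  · subst h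
    simpa using hv
  · simp [h]

/-- The inclusion `Sym_± V → Sym_± V^n` of the `l`-th factor. -/
def incl {n : ℕ} (l : Fin n) : SymPM 𝒱 →ₐ[k] SymPow 𝒱 n :=
  superMap 1 (LinearMap.single k (fun _ => V) l) (single_mem 𝒱 l)

theorem incl_gen {n : ℕ} (l : Fin n) (v : V) :
    incl 𝒱 l (gen 1 𝒱 v) = gen 1 (powGrading 𝒱 n) (Pi.single l v) :=
  superMap_gen _ _ v

/-- The multilinear map `(f_1, …, f_n) ↦ f_1^{(1)} ⋯ f_n^{(n)}` from `Sym_± V` to `Sym_± V^n`, where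
`f^{(l)}` is the image of `f` under the inclusion of the `l`-th factor. -/
def mulIncl (n : ℕ) : MultilinearMap k (fun _ : Fin n => SymPM 𝒱) (SymPow 𝒱 n) :=
  (MultilinearMap.mkPiAlgebraFin k n (SymPow 𝒱 n)).compLinearMap fun l => (incl 𝒱 l).toLinearMap

theorem mulIncl_apply {n : ℕ} (f : Fin n → SymPM 𝒱) :
    mulIncl 𝒱 n f = (List.ofFn fun l => incl 𝒱 l (f l)).prod := by
  simp [mulIncl]

theorem mulIncl_eq {n : ℕ} (f : Fin n → SymPM 𝒱) :
    mulIncl 𝒱 n f = ((List.finRange n).map fun l => incl 𝒱 l (f l)).prod := by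
  rw [mulIncl_apply, List.ofFn_eq_map]

variable {𝒱} (h𝒱 : DirectSum.IsInternal 𝒱)

/-- The operators on the tensor factors through which an element `v ∈ V_e` of the `l`-th summand of
`V^n` acts on `(Sym_± V)^{⊗ n}`: left multiplication by `v` on the `l`-th factor, and the parity
operator `P^e` on the factors that `v` has to pass on its way there. -/
def factorFamily {n : ℕ} (l : Fin n) (e : ZMod 2) (v : V) (j : Fin n) : SymPM 𝒱 →ₗ[k] SymPM 𝒱 :=
  if j < l then parityPow h𝒱 e else if j = l then LinearMap.mul k _ (gen 1 𝒱 v) else LinearMap.id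

/-- The action of `v ∈ V_e`, placed in the `l`-th summand of `V^n`, on `(Sym_± V)^{⊗ n}`. -/
def factorOp {n : ℕ} (l : Fin n) (e : ZMod 2) :
    V →ₗ[k] Module.End k (⨂[k] _ : Fin n, SymPM 𝒱) :=
  (PiTensorProduct.mapMultilinear k (fun _ : Fin n => SymPM 𝒱) fun _ => SymPM 𝒱).toLinearMap
    (fun j => if j < l then parityPow h𝒱 e else LinearMap.id) l ∘ₗ
      LinearMap.mul k (SymPM 𝒱) ∘ₗ gen 1 𝒱

theorem factorOp_apply {n : ℕ} (l : Fin n) (e : ZMod 2) (v : V) :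
    factorOp h𝒱 l e v = PiTensorProduct.map (factorFamily h𝒱 l e v) := by
  simp only [factorOp, LinearMap.comp_apply, MultilinearMap.toLinearMap_apply,
    PiTensorProduct.mapMultilinear_apply]
  congr 1
  ext1 j
  by_cases h : j = l
  · subst h
    simp [factorFamily]
  · simp [factorFamily, h]

theorem factorOp_mul_factorOp {n : ℕ} (l m : Fin n) {e f : ZMod 2} {v w : V} (hv : v ∈ 𝒱 e)
    (hw : w ∈ 𝒱 f) :
    factorOp h𝒱 l e v * factorOp h𝒱 m f w =
      (-1 : k) ^ (e.val * f.val) • (factorOp h𝒱 m f w * factorOp h𝒱 l e v) := by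
  have key (j : Fin n) : factorFamily h𝒱 l e v j * factorFamily h𝒱 m f w j =
      (if j = min l m then (-1 : k) ^ (e.val * f.val) else 1) •
        (factorFamily h𝒱 m f w j * factorFamily h𝒱 l e v j) := by
    have hvw := gen_swap 1 𝒱 e f v w hv hw
    -- for `l ≠ m` the sign arises at the smaller of the two positions, where one of the two left
    -- multiplications meets the parity operator of the other element
    have hPv (x : SymPM 𝒱) : gen 1 𝒱 v * parityPow h𝒱 f x =
        (-1 : k) ^ (e.val * f.val) • parityPow h𝒱 f (gen 1 𝒱 v * x) := by
      rw [parityPow_mul, parityPow_gen h𝒱 hv, smul_mul_assoc, smul_smul, mul_comm f.val, ← mul_pow]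
      simp
    have hPw (x : SymPM 𝒱) : parityPow h𝒱 e (gen 1 𝒱 w * x) =
        (-1 : k) ^ (e.val * f.val) • (gen 1 𝒱 w * parityPow h𝒱 e x) := by
      rw [parityPow_mul, parityPow_gen h𝒱 hw, smul_mul_assoc]
    have hPP : parityPow h𝒱 e * parityPow h𝒱 f = parityPow h𝒱 f * parityPow h𝒱 e := by
      simp only [parityPow, ← pow_add, add_comm]
    by_cases hjl : j = l
    · subst hjl
      rcases lt_trichotomy j m with hjm | rfl | hjm
      · ext x
        simp [factorFamily, hjm, hjm.le, hPv]
      · ext x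
        simp [factorFamily, ← mul_assoc, hvw]
      · simp [factorFamily, hjm.not_gt, hjm.ne', hjm.not_ge, ← Module.End.one_eq_id]
    · by_cases hjm : j = m
      · subst hjm
        rcases lt_or_gt_of_ne hjl with hjl' | hjl'
        · ext x
          simp [factorFamily, hjl', hjl'.le, hPw]
        · simp [factorFamily, hjl'.not_gt, hjl, hjl'.not_ge, ← Module.End.one_eq_id]
      · have hmin : j ≠ min l m := by
          rcases min_choice l m with h | h <;> rwa [h]
        simp only [factorFamily, hjl, hjm, hmin, if_false, one_smul, ← Module.End.one_eq_id]
        split_ifs <;> simp [hPP]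
  rw [factorOp_apply, factorOp_apply, ← PiTensorProduct.map_mul, ← PiTensorProduct.map_mul]
  let M := PiTensorProduct.mapMultilinear k (fun _ : Fin n => SymPM 𝒱) fun _ => SymPM 𝒱
  have := M.map_smul_univ
    (fun j => if j = min l m then (-1 : k) ^ (e.val * f.val) else 1)
    (fun j => factorFamily h𝒱 m f w j * factorFamily h𝒱 l e v j)
  simp only [M, PiTensorProduct.mapMultilinear_apply, ← key, Finset.prod_ite_eq', Finset.mem_univ,
    if_true] at this
  exact this

/-- The action of `Sym_± V^n` on `(Sym_± V)^{⊗ n}` by left multiplication. -/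
def tensorAction (n : ℕ) : SymPow 𝒱 n →ₐ[k] Module.End k (⨂[k] _ : Fin n, SymPM 𝒱) :=
  SuperAlg.lift (∑ l : Fin n, ∑ e, factorOp h𝒱 l e ∘ₗ proj h𝒱 e ∘ₗ LinearMap.proj l)
    fun i j a ha b hb => by
      have key {i : ZMod 2} {a : Fin n → V} (ha : a ∈ powGrading 𝒱 n i) :
          (∑ l : Fin n, ∑ e, factorOp h𝒱 l e ∘ₗ proj h𝒱 e ∘ₗ LinearMap.proj l) a =
            ∑ l : Fin n, factorOp h𝒱 l i (a l) := by
        simp only [LinearMap.sum_apply, LinearMap.comp_apply, LinearMap.proj_apply]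
        refine Finset.sum_congr rfl fun l _ => ?_
        simp only [proj_of_mem h𝒱 (ha l trivial)]
        rw [Finset.sum_eq_single i] <;> simp +contextual
      rw [key ha, key hb, Finset.sum_mul_sum, Finset.sum_mul_sum, Finset.sum_comm, Finset.smul_sum]
      refine Finset.sum_congr rfl fun m _ => ?_
      rw [Finset.smul_sum]
      refine Finset.sum_congr rfl fun l _ => ?_
      simpa using factorOp_mul_factorOp h𝒱 l m (ha l trivial) (hb m trivial)

theorem tensorAction_gen_single {n : ℕ} (l : Fin n) (v : V) :
    tensorAction h𝒱 n (gen 1 (powGrading 𝒱 n) (Pi.single l v)) =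
      ∑ e, factorOp h𝒱 l e (proj h𝒱 e v) := by
  simp only [tensorAction, SuperAlg.lift_gen, LinearMap.sum_apply, LinearMap.comp_apply,
    LinearMap.proj_apply]
  rw [Finset.sum_eq_single l]
  · simp
  · intro m _ hm
    simp [hm]
  · simp

/-- An element of the `l`-th copy of `Sym_± V` multiplies the `l`-th tensor factor. The factors in
front of it are required to be `1`, so that the parity operators have no effect on them. -/
theorem tensorAction_incl {n : ℕ} (l : Fin n) (f : SymPM 𝒱) (h : Fin n → SymPM 𝒱)
    (hh : ∀ j < l, h j = 1) :
    tensorAction h𝒱 n (incl 𝒱 l f) (tprod k h) = tprod k (Function.update h l (f * h l)) := by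
  induction f using SuperAlg.induction generalizing h with
  | algebraMap r =>
    simp only [AlgHom.commutes, ← Algebra.smul_def, MultilinearMap.map_update_smul,
      Function.update_eq_self]
    simp [Module.algebraMap_end_apply]
  | gen v =>
    rw [incl_gen, tensorAction_gen_single, LinearMap.sum_apply]
    have (e : ZMod 2) : factorOp h𝒱 l e (proj h𝒱 e v) (tprod k h) =
        (PiTensorProduct.tprod k).toLinearMap h l (gen 1 𝒱 (proj h𝒱 e v) * h l) := by
      rw [factorOp_apply, PiTensorProduct.map_tprod, MultilinearMap.toLinearMap_apply]
      congr 1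
      ext1 j
      rcases lt_trichotomy j l with hj | rfl | hj
      · simp [factorFamily, hj, hj.ne, hh j hj]
      · simp [factorFamily]
      · simp [factorFamily, hj.not_gt, hj.ne']
    simp only [this, ← map_sum, ← Finset.sum_mul, sum_proj h𝒱]
    rfl
  | mul a b ha hb =>
    rw [map_mul, map_mul, Module.End.mul_apply, hb h hh, ha]
    · simp [mul_assoc]
    · intro j hj
      simp [hj.ne, hh j hj]
  | add a b ha hb =>
    rw [map_add, map_add, LinearMap.add_apply, ha h hh, hb h hh, add_mul,
      MultilinearMap.map_update_add]

/-- The product is taken over an increasing list of positions: its last factor acts first, so that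
each further factor meets only `1`s at the positions in front of its own. -/
theorem tensorAction_prod_incl {n : ℕ} (f : Fin n → SymPM 𝒱) (ls : List (Fin n))
    (hls : ls.Pairwise (· < ·)) :
    tensorAction h𝒱 n (ls.map fun l => incl 𝒱 l (f l)).prod (tprod k 1) =
      tprod k (fun j => if j ∈ ls then f j else 1) := by
  induction ls with
  | nil => simp [Pi.one_def]
  | cons l ls ih =>
    rw [List.pairwise_cons] at hls
    rw [List.map_cons, List.prod_cons, map_mul, Module.End.mul_apply, ih hls.2, tensorAction_incl]
    · congr 1
      ext1 j
      by_cases hj : j = l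
      · subst hj
        have : j ∉ ls := fun h => lt_irrefl _ (hls.1 j h)
        simp [this]
      · simp [hj]
    · intro j hj
      have : j ∉ ls := fun h => lt_asymm hj (hls.1 j h)
      simp [this]

theorem tensorAction_mulIncl {n : ℕ} (f : Fin n → SymPM 𝒱) :
    tensorAction h𝒱 n (mulIncl 𝒱 n f) (tprod k 1) = tprod k f := by
  rw [mulIncl_eq, tensorAction_prod_incl h𝒱 f _ (List.pairwise_lt_finRange n)]
  simp

variable (𝒱) in
/-- The linear map `(Sym_± V)^{⊗ n} → Sym_± V^n`, `f_1 ⊗ ⋯ ⊗ f_n ↦ f_1^{(1)} ⋯ f_n^{(n)}`. -/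
def tensorMap (n : ℕ) : (⨂[k] _ : Fin n, SymPM 𝒱) →ₗ[k] SymPow 𝒱 n :=
  PiTensorProduct.lift (mulIncl 𝒱 n)

theorem tensorMap_injective (h𝒱 : DirectSum.IsInternal 𝒱) (n : ℕ) :
    Function.Injective (tensorMap 𝒱 n) := by
  have : (tensorAction h𝒱 n).toLinearMap.flip (tprod k 1) ∘ₗ tensorMap 𝒱 n = LinearMap.id := by
    ext f
    simp [tensorMap, tensorAction_mulIncl]
  exact Function.LeftInverse.injective (g := (tensorAction h𝒱 n).toLinearMap.flip (tprod k 1))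
    (DFunLike.congr_fun this)

theorem gen_single_mul_incl {n : ℕ} (l j : Fin n) {e : ZMod 2} {v : V} (hv : v ∈ 𝒱 e)
    (f : SymPM 𝒱) :
    gen 1 (powGrading 𝒱 n) (Pi.single l v) * incl 𝒱 j f =
      incl 𝒱 j (parityPow h𝒱 e f) * gen 1 (powGrading 𝒱 n) (Pi.single l v) := by
  induction f using SuperAlg.induction with
  | algebraMap r =>
    rw [Algebra.algebraMap_eq_smul_one]
    simp
  | gen w =>
    have key {f : ZMod 2} {w : V} (hw : w ∈ 𝒱 f) :
        gen 1 (powGrading 𝒱 n) (Pi.single l v) * incl 𝒱 j (gen 1 𝒱 w) =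
        incl 𝒱 j (parityPow h𝒱 e (gen 1 𝒱 w)) * gen 1 (powGrading 𝒱 n) (Pi.single l v) := by
      rw [parityPow_gen h𝒱 hw, map_smul, incl_gen,
        gen_swap 1 (powGrading 𝒱 n) e f _ _ (single_mem 𝒱 l e v hv) (single_mem 𝒱 j f w hw)]
      simp
    rw [← sum_proj h𝒱 w]
    simp only [map_sum, Finset.mul_sum, Finset.sum_mul]
    exact Finset.sum_congr rfl fun f _ => key (proj_mem h𝒱 f w)
  | mul a b ha hb => rw [map_mul, ← mul_assoc, ha, mul_assoc, hb, parityPow_mul, map_mul, mul_assoc]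
  | add a b ha hb => rw [map_add, mul_add, ha, hb, map_add, map_add, add_mul]

/-- Moving `v` to its place in an increasing product of factors changes the factors in the same way
as `factorOp` does. -/
theorem gen_single_mul_prod_incl {n : ℕ} (l : Fin n) {e : ZMod 2} {v : V} (hv : v ∈ 𝒱 e)
    (f : Fin n → SymPM 𝒱) (ls : List (Fin n)) (hls : ls.Pairwise (· < ·)) (hl : l ∈ ls) :
    gen 1 (powGrading 𝒱 n) (Pi.single l v) * (ls.map fun j => incl 𝒱 j (f j)).prod =
      (ls.map fun j => incl 𝒱 j (factorFamily h𝒱 l e v j (f j))).prod := by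
  induction ls with
  | nil => simp at hl
  | cons j ls ih =>
    rw [List.pairwise_cons] at hls
    rw [List.map_cons, List.map_cons, List.prod_cons, List.prod_cons]
    by_cases hj : l = j
    · subst hj
      have : (ls.map fun j => incl 𝒱 j (factorFamily h𝒱 l e v j (f j))) =
          ls.map fun j => incl 𝒱 j (f j) := by
        refine List.map_congr_left fun m hm => ?_
        have := hls.1 m hm
        simp [factorFamily, this.not_gt, this.ne']
      rw [this, ← mul_assoc]
      simp [factorFamily, incl_gen]
    · have hl' : l ∈ ls := (List.mem_cons.1 hl).resolve_left hj
      rw [← mul_assoc, gen_single_mul_incl h𝒱 l j hv, mul_assoc, ih hls.2 hl']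
      simp [factorFamily, hls.1 l hl']

theorem tensorMap_surjective (h𝒱 : DirectSum.IsInternal 𝒱) (n : ℕ) :
    Function.Surjective (tensorMap 𝒱 n) := by
  have hgen (l : Fin n) (e : ZMod 2) (v : V) (hv : v ∈ 𝒱 e) (t : ⨂[k] _ : Fin n, SymPM 𝒱) :
      gen 1 (powGrading 𝒱 n) (Pi.single l v) * tensorMap 𝒱 n t =
        tensorMap 𝒱 n (factorOp h𝒱 l e v t) := by
    have : LinearMap.mul k _ (gen 1 (powGrading 𝒱 n) (Pi.single l v)) ∘ₗ tensorMap 𝒱 n =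
        tensorMap 𝒱 n ∘ₗ factorOp h𝒱 l e v := by
      ext f
      simp only [LinearMap.compMultilinearMap_apply, LinearMap.comp_apply, factorOp_apply,
        PiTensorProduct.map_tprod, tensorMap, PiTensorProduct.lift.tprod, mulIncl_eq]
      exact gen_single_mul_prod_incl h𝒱 l hv f _ (List.pairwise_lt_finRange n) (List.mem_finRange l)
    exact DFunLike.congr_fun this t
  -- the range is a left ideal, and it contains `1`
  have key (x : SymPow 𝒱 n) (y) (hy : y ∈ LinearMap.range (tensorMap 𝒱 n)) :
      x * y ∈ LinearMap.range (tensorMap 𝒱 n) := by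
    induction x using SuperAlg.induction generalizing y with
    | algebraMap r =>
      rw [← Algebra.smul_def]
      exact Submodule.smul_mem _ r hy
    | gen v =>
      obtain ⟨t, rfl⟩ := hy
      rw [← Finset.univ_sum_single v, map_sum, Finset.sum_mul]
      refine Submodule.sum_mem _ fun l _ => ?_
      rw [← sum_proj h𝒱 (v l)]
      have : (Pi.single l (∑ e, proj h𝒱 e (v l)) : Fin n → V) =
          ∑ e, Pi.single l (proj h𝒱 e (v l)) := map_sum (LinearMap.single k (fun _ => V) l) _ _
      rw [this, map_sum, Finset.sum_mul]
      exact Submodule.sum_mem _ fun e _ => ⟨_, (hgen l e _ (proj_mem h𝒱 e _) t).symm⟩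
    | mul a b ha hb => exact mul_assoc a b y ▸ ha _ (hb y hy)
    | add a b ha hb => exact add_mul a b y ▸ Submodule.add_mem _ (ha y hy) (hb y hy)
  intro x
  have hone : (1 : SymPow 𝒱 n) ∈ LinearMap.range (tensorMap 𝒱 n) :=
    ⟨tprod k 1, by simp [tensorMap, mulIncl_eq]⟩
  simpa using key x 1 hone

end TensorPower

/-! ### Invariants under `G^n` -/

section Invariants

variable {k V : Type*} [Field k] [AddCommGroup V] [Module k V] {𝒱 : ZMod 2 → Submodule k V}
  {G : Subgroup (V ≃ₗ[k] V)} (hG : Respects G 𝒱)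

/-- The action of `g ∈ G` on `Sym_± V`. -/
def act (g : G) : SymPM 𝒱 →ₐ[k] SymPM 𝒱 :=
  superMap 1 (g : V ≃ₗ[k] V).toLinearMap (hG g g.2)

theorem mem_invariants {x : SymPM 𝒱} : x ∈ invariants hG ↔ ∀ g, act hG g x = x := by
  simp [invariants, act]

theorem act_act (g h : G) (x : SymPM 𝒱) : act hG g (act hG h x) = act hG (g * h) x :=
  superMap_superMap _ _ _ _ _ _ (fun _ => rfl) x

variable [Fintype G]

/-- The averaging operator `f ↦ |G|⁻¹ ∑_g g f` from `Sym_± V` to `U = (Sym_± V)^G`. -/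
def average : SymPM 𝒱 →ₗ[k] invariants hG :=
  ((Fintype.card G : k)⁻¹ • ∑ g, (act hG g).toLinearMap).codRestrict (invariants hG) fun x => by
    refine (mem_invariants hG).2 fun g => ?_
    simp only [LinearMap.smul_apply, LinearMap.sum_apply, AlgHom.toLinearMap_apply, map_smul,
      map_sum, act_act]
    congr 1
    exact Fintype.sum_equiv (Equiv.mulLeft g) _ _ fun _ => rfl

theorem coe_average (x : SymPM 𝒱) :
    (average hG x : SymPM 𝒱) = (Fintype.card G : k)⁻¹ • ∑ g, act hG g x := by
  simp [average]

theorem average_coe [CharZero k] (u : invariants hG) : average hG u = u := by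
  ext
  rw [coe_average]
  simp [(mem_invariants hG).1 u.2, ← Nat.cast_smul_eq_nsmul k, smul_smul]

theorem average_mem_invBideg {i j : ℕ} {x : SymPM 𝒱} (hx : x ∈ bideg 𝒱 i j) :
    average hG x ∈ invBideg hG i j := by
  change (average hG x : SymPM 𝒱) ∈ bideg 𝒱 i j
  rw [coe_average]
  exact Submodule.smul_mem _ _ (Submodule.sum_mem _ fun g _ => superMap_mem_bideg _ _ hx)

theorem iSup_invBideg [CharZero k] (h : ⨆ i, 𝒱 i = ⊤) :
    ⨆ d : ℕ × ℕ, invBideg hG d.1 d.2 = ⊤ := by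
  refine eq_top_iff.2 fun u _ => ?_
  have : ⨆ d : ℕ × ℕ, bideg 𝒱 d.1 d.2 ≤
      (⨆ d : ℕ × ℕ, invBideg hG d.1 d.2).comap (average hG) := iSup_le fun d x hx =>
    le_iSup (fun d : ℕ × ℕ => invBideg hG d.1 d.2) d (average_mem_invBideg hG hx)
  rw [iSup_bideg h] at this
  rw [← average_coe hG u]
  exact this trivial

end Invariants

section Actions

open scoped TensorProduct
open PiTensorProduct

variable {k V : Type*} [Field k] [AddCommGroup V] [Module k V] {𝒱 : ZMod 2 → Submodule k V}
  {G : Subgroup (V ≃ₗ[k] V)} (hG : Respects G 𝒱) {n : ℕ}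

variable (𝒱) in
/-- The action of a permutation on `Sym_± V^n`. -/
def permAct (τ : Equiv.Perm (Fin n)) : SymPow 𝒱 n →ₐ[k] SymPow 𝒱 n :=
  superMap 1 (permMap τ) (permMap_mem 𝒱 τ)

/-- The action of `G^n` on `Sym_± V^n`. -/
def slotAct (g : Fin n → G) : SymPow 𝒱 n →ₐ[k] SymPow 𝒱 n :=
  superMap 1 (wreathMap 1 g) (wreathMap_mem hG 1 g)

theorem permAct_mul (σ τ : Equiv.Perm (Fin n)) (x : SymPow 𝒱 n) :
    permAct 𝒱 (σ * τ) x = permAct 𝒱 σ (permAct 𝒱 τ x) :=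
  (superMap_superMap _ _ _ _ _ _ (fun v => by ext l; simp [permMap, mul_inv_rev]) x).symm

@[simp] theorem permAct_one (x : SymPow 𝒱 n) : permAct 𝒱 1 x = x :=
  superMap_eq_self _ _ (fun v => by ext l; simp [permMap]) x

theorem superMap_wreathMap (σ : Equiv.Perm (Fin n)) (g : Fin n → G) (x : SymPow 𝒱 n) :
    superMap 1 (wreathMap σ g) (wreathMap_mem hG σ g) x = permAct 𝒱 σ (slotAct hG g x) :=
  (superMap_superMap _ _ _ _ _ _ (fun v => by ext l; simp [permMap, wreathMap]) x).symm

theorem slotAct_permAct (σ : Equiv.Perm (Fin n)) (g : Fin n → G) (x : SymPow 𝒱 n) :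
    slotAct hG g (permAct 𝒱 σ x) = permAct 𝒱 σ (slotAct hG (g ∘ σ) x) := by
  rw [← superMap_wreathMap]
  exact superMap_superMap _ _ _ _ _ _ (fun v => by ext l; simp [permMap, wreathMap]) x

theorem slotAct_one (x : SymPow 𝒱 n) : slotAct hG 1 x = x :=
  superMap_eq_self _ _ (fun v => by ext l; simp [wreathMap]) x

theorem mem_wreathInvariants {χ : Equiv.Perm (Fin n) →* ℤˣ} {x : SymPow 𝒱 n} :
    x ∈ wreathInvariants hG n χ ↔
      (∀ g, slotAct hG g x = x) ∧ ∀ σ, permAct 𝒱 σ x = ((χ σ : ℤ) : k) • x := by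
  have : x ∈ wreathInvariants hG n χ ↔
      ∀ σ g, permAct 𝒱 σ (slotAct hG g x) = ((χ σ : ℤ) : k) • x := by
    simp only [wreathInvariants, Submodule.mem_iInf]
    refine forall₂_congr fun σ g => ?_
    rw [← superMap_wreathMap]
    rfl
  rw [this]
  refine ⟨fun h => ⟨fun g => ?_, fun σ => ?_⟩, fun h σ g => ?_⟩
  · simpa using h 1 g
  · simpa [slotAct_one] using h σ 1
  · rw [h.1, h.2]

theorem permAct_incl (σ : Equiv.Perm (Fin n)) (l : Fin n) (f : SymPM 𝒱) :
    permAct 𝒱 σ (incl 𝒱 l f) = incl 𝒱 (σ l) f :=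
  superMap_superMap _ _ _ _ _ _ (fun v => by
    ext m
    simp [permMap, LinearMap.funLeft_apply, Pi.single_apply, Equiv.symm_apply_eq]) f

theorem slotAct_incl (g : Fin n → G) (l : Fin n) (f : SymPM 𝒱) :
    slotAct hG g (incl 𝒱 l f) = incl 𝒱 l (act hG (g l) f) := by
  let h : V →ₗ[k] (Fin n → V) := LinearMap.single k (fun _ => V) l ∘ₗ (g l : V ≃ₗ[k] V).toLinearMap
  have hh (i : ZMod 2) (v : V) (hv : v ∈ 𝒱 i) : h v ∈ powGrading 𝒱 n i :=
    single_mem 𝒱 l i _ (hG _ (g l).2 i v hv)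
  refine Eq.trans (superMap_superMap _ _ _ _ h hh (fun v => ?_) f)
    (superMap_superMap _ _ _ _ h hh (fun v => rfl) f).symm
  ext m
  by_cases hm : m = l
  · subst hm
    simp [wreathMap, h]
  · simp [wreathMap, h, hm]

theorem slotAct_tensorMap (g : Fin n → G) (t : ⨂[k] _ : Fin n, SymPM 𝒱) :
    slotAct hG g (tensorMap 𝒱 n t) =
      tensorMap 𝒱 n (PiTensorProduct.map (fun l => (act hG (g l)).toLinearMap) t) := by
  have : (slotAct hG g).toLinearMap ∘ₗ tensorMap 𝒱 n =
      tensorMap 𝒱 n ∘ₗ PiTensorProduct.map (fun l => (act hG (g l)).toLinearMap) := by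
    ext f
    simp [tensorMap, mulIncl_apply, map_list_prod, List.map_ofFn, Function.comp_def, slotAct_incl]
  exact DFunLike.congr_fun this t

/-- The linear map `U^{⊗ n} → Sym_± V^n`, `u_1 ⊗ ⋯ ⊗ u_n ↦ u_1^{(1)} ⋯ u_n^{(n)}`, where
`U = (Sym_± V)^G`. -/
def invMap (n : ℕ) : (⨂[k]^n (invariants hG)) →ₗ[k] SymPow 𝒱 n :=
  tensorMap 𝒱 n ∘ₗ PiTensorProduct.map fun _ => (invariants hG).subtype

theorem invMap_tprod (u : Fin n → invariants hG) :
    invMap hG n (tprod k u) = (List.ofFn fun l => incl 𝒱 l (u l : SymPM 𝒱)).prod := by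
  simp [invMap, tensorMap, mulIncl_apply]

theorem slotAct_invMap (g : Fin n → G) (t : ⨂[k]^n (invariants hG)) :
    slotAct hG g (invMap hG n t) = invMap hG n t := by
  rw [invMap, LinearMap.comp_apply, slotAct_tensorMap,
    ← LinearMap.comp_apply (PiTensorProduct.map _), ← PiTensorProduct.map_comp]
  congr 3
  ext1 l
  ext u
  exact (mem_invariants hG).1 u.2 (g l)

variable [Fintype G] [CharZero k]

theorem invMap_injective (h𝒱 : DirectSum.IsInternal 𝒱) : Function.Injective (invMap hG n) := by
  refine (tensorMap_injective h𝒱 n).comp ?_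
  have : PiTensorProduct.map (fun _ : Fin n => average hG) ∘ₗ
      PiTensorProduct.map (fun _ => (invariants hG).subtype) = LinearMap.id := by
    rw [← PiTensorProduct.map_comp, ← PiTensorProduct.map_id]
    congr 1
    ext1 l
    ext1 u
    exact average_coe hG u
  exact Function.LeftInverse.injective (DFunLike.congr_fun this)

/-- Every `G^n`-invariant comes from `U^{⊗ n}`. -/
theorem exists_invMap_eq (h𝒱 : DirectSum.IsInternal 𝒱) {x : SymPow 𝒱 n}
    (hx : ∀ g, slotAct hG g x = x) : ∃ t, invMap hG n t = x := by
  obtain ⟨t, rfl⟩ := tensorMap_surjective h𝒱 n x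
  refine ⟨PiTensorProduct.map (fun _ => average hG) t, ?_⟩
  have havg : (invariants hG).subtype ∘ₗ average hG =
      (Fintype.card G : k)⁻¹ • ∑ g, (act hG g).toLinearMap := by
    ext f
    simp [coe_average]
  -- averaging every tensor factor over `G` is averaging over `G^n`
  have hmap : PiTensorProduct.map (fun _ : Fin n => (invariants hG).subtype ∘ₗ average hG) =
      ((Fintype.card G : k)⁻¹) ^ n • ∑ g : Fin n → G,
        PiTensorProduct.map fun l => (act hG (g l)).toLinearMap := by
    let M := PiTensorProduct.mapMultilinear k (fun _ : Fin n => SymPM 𝒱) fun _ => SymPM 𝒱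
    have h1 := M.map_smul_univ (fun _ => (Fintype.card G : k)⁻¹)
      fun _ => ∑ g, (act hG g).toLinearMap
    have h2 := M.map_sum fun (_ : Fin n) (g : G) => (act hG g).toLinearMap
    rw [h2] at h1
    simpa [M, havg] using h1
  rw [invMap, LinearMap.comp_apply, ← LinearMap.comp_apply (PiTensorProduct.map _),
    ← PiTensorProduct.map_comp, hmap]
  simp only [LinearMap.smul_apply, LinearMap.sum_apply, map_smul, map_sum, ← slotAct_tensorMap, hx]
  simp [← Nat.cast_smul_eq_nsmul k, smul_smul]

end Actions

/-! ### Permutations and the kernel of symmetrization -/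

section AdjacentSwap

/-- Exchanging two adjacent factors that commute up to the scalar `c` multiplies a product
by `c`. -/
theorem prod_ofFn_swap {k A : Type*} [Field k] [Ring A] [Algebra k A] {n : ℕ} (y : Fin (n + 1) → A)
    (i : Fin n) (c : k) (h : y i.succ * y i.castSucc = c • (y i.castSucc * y i.succ)) :
    (List.ofFn fun l => y (Equiv.swap i.castSucc i.succ l)).prod = c • (List.ofFn y).prod := by
  induction n with
  | zero => exact i.elim0
  | succ n ih =>
    cases i using Fin.cases with
    | zero =>
      have h2 (l : Fin n) : Equiv.swap (0 : Fin (n + 2)) 1 l.succ.succ = l.succ.succ :=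
        Equiv.swap_apply_of_ne_of_ne (Fin.succ_ne_zero _)
          (by
            rw [← Fin.succ_zero_eq_one]
            exact fun h => Fin.succ_ne_zero _ (Fin.succ_injective _ h))
      simp only [Fin.castSucc_zero, Fin.succ_zero_eq_one, List.ofFn_succ, List.prod_cons, h2,
        Equiv.swap_apply_left, Equiv.swap_apply_right] at h ⊢
      rw [← mul_assoc, h, smul_mul_assoc, mul_assoc]
    | succ j =>
      have h0 : Equiv.swap j.succ.castSucc j.succ.succ 0 = 0 :=
        Equiv.swap_apply_of_ne_of_ne (by simp [Fin.ext_iff]) (Fin.succ_ne_zero _).symm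
      have h1 (l : Fin (n + 1)) : Equiv.swap j.succ.castSucc j.succ.succ l.succ =
          (Equiv.swap j.castSucc j.succ l).succ := by
        rw [← Fin.succ_castSucc]
        exact (Fin.succ_injective _).swap_apply _ _ _
      rw [List.ofFn_succ, List.ofFn_succ (f := y), List.prod_cons, List.prod_cons, h0]
      simp only [h1]
      rw [ih (fun l => y l.succ) j (by simpa using h), mul_smul_comm]

end AdjacentSwap

section Kernel

open scoped TensorProduct
open PiTensorProduct

variable {k V : Type*} [Field k] [AddCommGroup V] [Module k V] {𝒱 : ZMod 2 → Submodule k V}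
  {G : Subgroup (V ≃ₗ[k] V)} (hG : Respects G 𝒱)

theorem SuperCommute.iSup_left {A : Type*} [Ring A] [Algebra k A] {ι : Sort*} {m : ℕ}
    {M : ι → Submodule k A} {N : Submodule k A} (h : ∀ i, SuperCommute m (M i) N) :
    SuperCommute m (⨆ i, M i) N := fun a ha b hb => by
  have : ⨆ i, M i ≤ LinearMap.eqLocus ((LinearMap.mul k A).flip b)
      ((-1 : k) ^ m • LinearMap.mul k A b) :=
    iSup_le fun i x hx => by simpa using h i x hx b hb
  simpa using this ha

theorem SuperCommute.congr {A : Type*} [Ring A] [Algebra k A] {m n : ℕ} {M N : Submodule k A}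
    (h : SuperCommute m M N) (hmn : (m : ZMod 2) = n) : SuperCommute n M N := fun a ha b hb => by
  rw [h a ha b hb, neg_one_pow_eq_pow_mod_two, (ZMod.natCast_eq_natCast_iff' m n 2).1 hmn,
    ← neg_one_pow_eq_pow_mod_two]

variable (𝒱) in
/-- The part of `Sym_± V` of parity `e`. -/
def parityPart (e : ZMod 2) : Submodule k (SymPM 𝒱) :=
  ⨆ (i : ℕ) (j : ℕ) (_ : (j : ZMod 2) = e), bideg 𝒱 i j

variable (𝒱) in
theorem superCommute_parityPart (e f : ZMod 2) :
    SuperCommute (e.val * f.val) (parityPart 𝒱 e) (parityPart 𝒱 f) := by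
  refine .iSup_left fun i => .iSup_left fun j => .iSup_left fun hj => .symm <|
    .iSup_left fun i' => .iSup_left fun j' => .iSup_left fun hj' => .symm <|
    (superCommute_bideg 𝒱 i j i' j').congr ?_
  simp [hj, hj']

theorem coe_mem_parityPart {e : ZMod 2} {u : invariants hG} (hu : u ∈ invParity hG e) :
    (u : SymPM 𝒱) ∈ parityPart 𝒱 e := by
  have : invParity hG e ≤ (parityPart 𝒱 e).comap (invariants hG).subtype :=
    iSup_le fun i => iSup_le fun j => iSup_le fun hj x hx =>
      (le_iSup_of_le i <| le_iSup_of_le j <| le_iSup_of_le (f := fun _ => bideg 𝒱 i j) hj le_rfl :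
        bideg 𝒱 i j ≤ parityPart 𝒱 e) hx
  exact this hu

theorem superMap_mem_parityPart {W : Type*} [AddCommGroup W] [Module k W]
    {𝒲 : ZMod 2 → Submodule k W} (f : V →ₗ[k] W) (hf : ∀ i, ∀ v ∈ 𝒱 i, f v ∈ 𝒲 i) {e : ZMod 2}
    {x : SymPM 𝒱} (hx : x ∈ parityPart 𝒱 e) : superMap 1 f hf x ∈ parityPart 𝒲 e := by
  have : parityPart 𝒱 e ≤ (parityPart 𝒲 e).comap (superMap 1 f hf).toLinearMap :=
    iSup_le fun i => iSup_le fun j => iSup_le fun hj x hx =>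
      (le_iSup_of_le i <| le_iSup_of_le j <| le_iSup_of_le (f := fun _ => bideg 𝒲 i j) hj le_rfl :
        bideg 𝒲 i j ≤ parityPart 𝒲 e) (superMap_mem_bideg f hf hx)
  exact this hx

variable (ε : ℤˣ)

/-- The canonical map from `U^{⊗ n}` to `Sym_± U` or `∧_± U`. -/
def tensorQuot (n : ℕ) : (⨂[k]^n (invariants hG)) →ₗ[k] SuperAlg ε (invParity hG) :=
  (quotMap ε (invParity hG)).toLinearMap ∘ₗ TensorPower.toTensorAlgebra

theorem tensorQuot_tprod {n : ℕ} (u : Fin n → invariants hG) :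
    tensorQuot hG ε n (tprod k u) = (List.ofFn fun l => gen ε (invParity hG) (u l)).prod := by
  simp [tensorQuot, TensorAlgebra.tprod_apply, map_list_prod, List.map_ofFn, Function.comp_def]

variable {n : ℕ} {e : Fin (n + 1) → ZMod 2} {u : Fin (n + 1) → invariants hG}

theorem unit_smul_unit_smul {M : Type*} [AddCommGroup M] [Module k M] (ε : ℤˣ) (x : M) :
    ((ε : ℤ) : k) • ((ε : ℤ) : k) • x = x := by
  obtain rfl | rfl := Int.units_eq_one_or ε <;> simp

theorem neg_one_pow_smul_smul {M : Type*} [AddCommGroup M] [Module k M] (m : ℕ) (x : M) :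
    (-1 : k) ^ m • (-1 : k) ^ m • x = x := by
  simp [smul_smul, ← mul_pow]

/-- Permuting the variables of a pure tensor by an adjacent transposition is, up to the Koszul sign,
permuting its factors. -/
theorem permAct_swap_invMap (hu : ∀ l, u l ∈ invParity hG (e l)) (i : Fin n) :
    permAct 𝒱 (Equiv.swap i.castSucc i.succ) (invMap hG (n + 1) (tprod k u)) =
      (-1 : k) ^ ((e i.castSucc).val * (e i.succ).val) •
        invMap hG (n + 1) (tprod k fun l => u (Equiv.swap i.castSucc i.succ l)) := by
  set s := Equiv.swap i.castSucc i.succ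
  have h := prod_ofFn_swap (fun l => incl 𝒱 l (u (s l) : SymPM 𝒱)) i
    ((-1 : k) ^ ((e i.castSucc).val * (e i.succ).val)) <| by
      simp only [s, Equiv.swap_apply_left, Equiv.swap_apply_right]
      exact superCommute_parityPart (powGrading 𝒱 (n + 1)) _ _ _
        (superMap_mem_parityPart _ _ (coe_mem_parityPart hG (hu _))) _
        (superMap_mem_parityPart _ _ (coe_mem_parityPart hG (hu _)))
  rw [invMap_tprod, invMap_tprod, ← h]
  simp [map_list_prod, List.map_ofFn, Function.comp_def, permAct_incl, s]

theorem tensorQuot_swap (hu : ∀ l, u l ∈ invParity hG (e l)) (i : Fin n) :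
    tensorQuot hG ε (n + 1) (tprod k fun l => u (Equiv.swap i.castSucc i.succ l)) =
      (((ε : ℤ) : k) * (-1 : k) ^ ((e i.castSucc).val * (e i.succ).val)) •
        tensorQuot hG ε (n + 1) (tprod k u) := by
  rw [tensorQuot_tprod, tensorQuot_tprod]
  refine prod_ofFn_swap (fun l => gen ε (invParity hG) (u l)) i _ ?_
  rw [mul_comm (e i.castSucc).val]
  exact gen_swap ε (invParity hG) _ _ _ _ (hu _) (hu _)

theorem mem_invParity {i j : ℕ} {u : invariants hG} (hu : u ∈ invBideg hG i j) :
    u ∈ invParity hG j :=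
  (le_iSup_of_le i <| le_iSup_of_le j <| le_iSup_of_le (f := fun _ => invBideg hG i j) rfl le_rfl :
    invBideg hG i j ≤ invParity hG j) hu

variable (𝒱) in
/-- The operator `x ↦ ∑_σ χ(σ) σ(x)` on `Sym_± V^n`. -/
def symmetrize {n : ℕ} (χ : Equiv.Perm (Fin n) →* ℤˣ) : SymPow 𝒱 n →ₗ[k] SymPow 𝒱 n :=
  ∑ σ, ((χ σ : ℤ) : k) • (permAct 𝒱 σ).toLinearMap

theorem symmetrize_apply {n : ℕ} (χ : Equiv.Perm (Fin n) →* ℤˣ) (x : SymPow 𝒱 n) :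
    symmetrize 𝒱 χ x = ∑ σ, ((χ σ : ℤ) : k) • permAct 𝒱 σ x := by
  simp [symmetrize]

theorem permAct_symmetrize {n : ℕ} (χ : Equiv.Perm (Fin n) →* ℤˣ) (τ : Equiv.Perm (Fin n))
    (x : SymPow 𝒱 n) : permAct 𝒱 τ (symmetrize 𝒱 χ x) = ((χ τ : ℤ) : k) • symmetrize 𝒱 χ x := by
  simp only [symmetrize_apply, map_sum, map_smul, ← permAct_mul, Finset.smul_sum]
  refine Fintype.sum_equiv (Equiv.mulLeft τ) _ _ fun σ => ?_
  rw [Equiv.coe_mulLeft, map_mul, Units.val_mul, Int.cast_mul, mul_smul, unit_smul_unit_smul]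

theorem symmetrize_permAct {n : ℕ} (χ : Equiv.Perm (Fin n) →* ℤˣ) (τ : Equiv.Perm (Fin n))
    (x : SymPow 𝒱 n) : symmetrize 𝒱 χ (permAct 𝒱 τ x) = ((χ τ : ℤ) : k) • symmetrize 𝒱 χ x := by
  simp only [symmetrize_apply, ← permAct_mul, Finset.smul_sum]
  refine Fintype.sum_equiv (Equiv.mulRight τ) _ _ fun σ => ?_
  rw [Equiv.coe_mulRight, map_mul, Units.val_mul, Int.cast_mul, mul_comm, mul_smul,
    unit_smul_unit_smul]

theorem symmetrize_invMap_mem {n : ℕ} (χ : Equiv.Perm (Fin n) →* ℤˣ) (t : ⨂[k]^n (invariants hG)) :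
    symmetrize 𝒱 χ (invMap hG n t) ∈ wreathInvariants hG n χ := by
  refine (mem_wreathInvariants hG).2 ⟨fun g => ?_, fun σ => permAct_symmetrize χ σ _⟩
  simp only [symmetrize_apply, map_sum, map_smul, slotAct_permAct, slotAct_invMap]

theorem symmetrize_of_mem {n : ℕ} {χ : Equiv.Perm (Fin n) →* ℤˣ} {x : SymPow 𝒱 n}
    (hx : x ∈ wreathInvariants hG n χ) : symmetrize 𝒱 χ x = (n.factorial : k) • x := by
  simp [symmetrize_apply, ((mem_wreathInvariants hG).1 hx).2, unit_smul_unit_smul,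
    Fintype.card_perm, ← Nat.cast_smul_eq_nsmul k]

variable [Fintype G] [CharZero k]

theorem span_tprod_homogeneous (h𝒱 : DirectSum.IsInternal 𝒱) (n : ℕ) :
    Submodule.span k {t : ⨂[k]^n (invariants hG) | ∃ (u : Fin n → invariants hG) (p q : Fin n → ℕ),
      (∀ l, u l ∈ invBideg hG (p l) (q l)) ∧ tprod k u = t} = ⊤ := by
  have hspan : Submodule.span k (Set.range
      (Subtype.val : {u : invariants hG // ∃ d : ℕ × ℕ, u ∈ invBideg hG d.1 d.2} → _)) = ⊤ := by
    rw [eq_top_iff, ← iSup_invBideg hG h𝒱.submodule_iSup_eq_top]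
    exact iSup_le fun d u hu => Submodule.subset_span ⟨⟨u, d, hu⟩, rfl⟩
  rw [eq_top_iff, ← PiTensorProduct.submodule_span_eq_top (ι := Fin n) fun _ => hspan]
  refine Submodule.span_mono ?_
  rintro _ ⟨u, rfl⟩
  choose d hd using fun l => (u l).2
  exact ⟨_, fun l => (d l).1, fun l => (d l).2, hd, rfl⟩

/-- The action of a permutation on the variables, twisted by `χ`, lifts to `U^{⊗ n}` in such a way
that it becomes trivial in `Sym_± U` or `∧_± U`. -/
theorem exists_invMap_eq_permAct (h𝒱 : DirectSum.IsInternal 𝒱) {n : ℕ}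
    {χ : Equiv.Perm (Fin n) →* ℤˣ}
    (hχ : ∀ i j : Fin n, (i : ℕ) + 1 = j → χ (Equiv.swap i j) = ε)
    (σ : Equiv.Perm (Fin n)) (t : ⨂[k]^n (invariants hG)) :
    ∃ t', invMap hG n t' = ((χ σ : ℤ) : k) • permAct 𝒱 σ (invMap hG n t) ∧
      tensorQuot hG ε n t' = tensorQuot hG ε n t := by
  cases n with
  | zero => exact ⟨t, by simp [Subsingleton.elim σ 1], rfl⟩
  | succ n =>
    have hσ : σ ∈ Submonoid.closure (Set.range fun i : Fin n => Equiv.swap i.castSucc i.succ) :=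
      Equiv.Perm.mclosure_swap_castSucc_succ n ▸ Submonoid.mem_top σ
    induction hσ using Submonoid.closure_induction generalizing t with
    | one => exact ⟨t, by simp, rfl⟩
    | mul σ τ _ _ hσ hτ =>
      obtain ⟨t₁, h₁, h₁'⟩ := hτ t
      obtain ⟨t₂, h₂, h₂'⟩ := hσ t₁
      exact ⟨t₂, by simp [h₂, h₁, permAct_mul, smul_smul], h₂'.trans h₁'⟩
    | mem σ hσ =>
      obtain ⟨i, rfl⟩ := hσ
      have ht : t ∈ Submodule.span k _ := span_tprod_homogeneous hG h𝒱 (n + 1) ▸ Submodule.mem_top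
      induction ht using Submodule.span_induction with
      | mem t ht =>
        obtain ⟨u, p, q, hu, rfl⟩ := ht
        have hu' (l) : u l ∈ invParity hG (q l : ZMod 2) := mem_invParity hG (hu l)
        refine ⟨(((ε : ℤ) : k) *
            (-1 : k) ^ ((q i.castSucc : ZMod 2).val * (q i.succ : ZMod 2).val)) •
          tprod k fun l => u (Equiv.swap i.castSucc i.succ l), ?_, ?_⟩
        · simp only
          rw [permAct_swap_invMap hG hu', map_smul, hχ _ _ (by simp), mul_smul]
        · rw [map_smul, tensorQuot_swap hG ε hu', mul_smul, mul_smul,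
            smul_comm ((-1 : k) ^ _) ((ε : ℤ) : k), neg_one_pow_smul_smul, unit_smul_unit_smul]
      | zero => exact ⟨0, by simp, rfl⟩
      | add x y _ _ hx hy =>
        obtain ⟨x', hx, hx'⟩ := hx
        obtain ⟨y', hy, hy'⟩ := hy
        exact ⟨x' + y', by simp [hx, hy], by simp [hx', hy']⟩
      | smul c x _ hx =>
        obtain ⟨x', hx, hx'⟩ := hx
        exact ⟨c • x', by simp [hx, smul_comm c], by simp [hx']⟩

/-- Every `χ`-relative invariant `x` is a symmetrization, namely that of `x / n!`. -/
theorem exists_symmetrize_invMap_eq (h𝒱 : DirectSum.IsInternal 𝒱) {n : ℕ}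
    {χ : Equiv.Perm (Fin n) →* ℤˣ} {x : SymPow 𝒱 n} (hx : x ∈ wreathInvariants hG n χ) :
    ∃ t, symmetrize 𝒱 χ (invMap hG n t) = x := by
  obtain ⟨t, rfl⟩ := exists_invMap_eq hG h𝒱 ((mem_wreathInvariants hG).1 hx).1
  refine ⟨(n.factorial : k)⁻¹ • t, ?_⟩
  rw [map_smul, map_smul, symmetrize_of_mem hG hx, smul_smul, inv_mul_cancel₀, one_smul]
  exact Nat.cast_ne_zero.2 n.factorial_ne_zero

/-- Symmetrization kills only those elements of `U^{⊗ n}` that vanish in `Sym_± U` or `∧_± U`. -/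
theorem tensorQuot_eq_zero (h𝒱 : DirectSum.IsInternal 𝒱) {n : ℕ}
    {χ : Equiv.Perm (Fin n) →* ℤˣ}
    (hχ : ∀ i j : Fin n, (i : ℕ) + 1 = j → χ (Equiv.swap i j) = ε)
    {t : ⨂[k]^n (invariants hG)} (ht : symmetrize 𝒱 χ (invMap hG n t) = 0) :
    tensorQuot hG ε n t = 0 := by
  -- `T σ` represents `χ(σ) σ` applied to `t`, so the `T σ` add up to the symmetrization of `t`;
  -- each has the same image as `t` in the quotient
  choose T hT hT' using fun σ => exists_invMap_eq_permAct hG ε h𝒱 hχ σ t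
  have h0 : ∑ σ, T σ = 0 := invMap_injective hG h𝒱 <| by
    rw [map_sum, map_zero, ← ht, symmetrize_apply]
    exact Finset.sum_congr rfl fun σ _ => hT σ
  have h1 : (n.factorial : k) • tensorQuot hG ε n t = 0 := by
    rw [← map_zero (tensorQuot hG ε n), ← h0, map_sum]
    simp [hT', Fintype.card_perm, ← Nat.cast_smul_eq_nsmul k]
  exact (smul_eq_zero.1 h1).resolve_left (Nat.cast_ne_zero.2 n.factorial_ne_zero)

end Kernel

/-! ### Shuffle products -/

section BlockPermutations

variable {a b : ℕ}

/-- The element `α × β` of the Young subgroup `𝔖_a × 𝔖_b` of `𝔖_{a+b}`. -/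
def blockPerm (α : Equiv.Perm (Fin a)) (β : Equiv.Perm (Fin b)) : Equiv.Perm (Fin (a + b)) :=
  finSumFinEquiv.permCongr (Equiv.sumCongr α β)

@[simp] theorem blockPerm_castAdd (α : Equiv.Perm (Fin a)) (β : Equiv.Perm (Fin b)) (i : Fin a) :
    blockPerm α β (Fin.castAdd b i) = Fin.castAdd b (α i) := by
  simp [blockPerm, Equiv.permCongr_apply]

@[simp] theorem blockPerm_natAdd (α : Equiv.Perm (Fin a)) (β : Equiv.Perm (Fin b)) (i : Fin b) :
    blockPerm α β (Fin.natAdd a i) = Fin.natAdd a (β i) := by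
  simp [blockPerm, Equiv.permCongr_apply]

theorem perm_ext_blocks {σ τ : Equiv.Perm (Fin (a + b))}
    (h : ∀ i, σ (Fin.castAdd b i) = τ (Fin.castAdd b i))
    (h' : ∀ i, σ (Fin.natAdd a i) = τ (Fin.natAdd a i)) : σ = τ :=
  Equiv.ext fun l => Fin.addCases h h' l

theorem mem_shuffles {τ : Equiv.Perm (Fin (a + b))} : τ ∈ shuffles a b ↔
    StrictMono (τ ∘ Fin.castAdd b) ∧ StrictMono (τ ∘ Fin.natAdd a) := by
  simp [shuffles, StrictMono]

/-- A permutation that sorts an injective tuple is unique. -/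
theorem eq_of_strictMono_comp {n m : ℕ} {f : Fin n → Fin m} {σ τ : Equiv.Perm (Fin n)}
    (hσ : StrictMono (f ∘ σ)) (hτ : StrictMono (f ∘ τ)) : σ = τ := by
  have hf : Function.Injective f := by
    simpa using hσ.injective.comp σ.symm.injective
  have := Tuple.unique_monotone hσ.monotone hτ.monotone
  exact Equiv.ext fun i => hf (congrFun this i)

/-- Every permutation is uniquely the product of a shuffle and an element of the Young subgroup. -/
theorem sum_shuffles_blockPerm {M : Type*} [AddCommMonoid M] (f : Equiv.Perm (Fin (a + b)) → M) :
    ∑ τ ∈ shuffles a b, ∑ α : Equiv.Perm (Fin a), ∑ β : Equiv.Perm (Fin b), f (τ * blockPerm α β) =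
      ∑ σ, f σ := by
  simp only [← Finset.sum_product', Finset.univ_product_univ]
  refine Finset.sum_bij (fun p _ => p.1 * blockPerm p.2.1 p.2.2) (fun _ _ => Finset.mem_univ _)
    ?_ ?_ fun _ _ => rfl
  · rintro ⟨τ, α, β⟩ h ⟨τ', α', β'⟩ h' heq
    simp only [Finset.mem_product, Finset.mem_univ, and_true, mem_shuffles] at h h' heq
    have hα : α⁻¹ = α'⁻¹ := by
      refine eq_of_strictMono_comp (f := ⇑(τ * blockPerm α β) ∘ Fin.castAdd b) ?_ ?_
      · convert h.1 using 1
        ext i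
        simp
      · rw [heq]
        convert h'.1 using 1
        ext i
        simp
    have hβ : β⁻¹ = β'⁻¹ := by
      refine eq_of_strictMono_comp (f := ⇑(τ * blockPerm α β) ∘ Fin.natAdd a) ?_ ?_
      · convert h.2 using 1
        ext i
        simp
      · rw [heq]
        convert h'.2 using 1
        ext i
        simp
    obtain rfl := inv_injective hα
    obtain rfl := inv_injective hβ
    rw [mul_right_cancel heq]
  · intro σ _
    -- sorting both blocks of values of `σ` turns it into a shuffle
    let α := Tuple.sort (⇑σ ∘ Fin.castAdd b)
    let β := Tuple.sort (⇑σ ∘ Fin.natAdd a)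
    refine ⟨(σ * blockPerm α β, α⁻¹, β⁻¹), ?_, ?_⟩
    · simp only [Finset.mem_product, Finset.mem_univ, and_true, mem_shuffles]
      constructor
      · convert (Tuple.monotone_sort (⇑σ ∘ Fin.castAdd b)).strictMono_of_injective
          ((σ.injective.comp (Fin.castAdd_injective a b)).comp (Equiv.injective _)) using 1
        ext i
        simp [α]
      · convert (Tuple.monotone_sort (⇑σ ∘ Fin.natAdd a)).strictMono_of_injective
          ((σ.injective.comp (Fin.natAdd_injective b a)).comp (Equiv.injective _)) using 1
        ext i
        simp [β]
    · refine perm_ext_blocks ?_ ?_ <;> simp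

theorem sign_blockPerm (α : Equiv.Perm (Fin a)) (β : Equiv.Perm (Fin b)) :
    Equiv.Perm.sign (blockPerm α β) = Equiv.Perm.sign α * Equiv.Perm.sign β := by
  rw [blockPerm, Equiv.Perm.sign_permCongr, Equiv.Perm.sign_sumCongr]

end BlockPermutations

section ShuffleProduct

open scoped TensorProduct
open PiTensorProduct

variable {k V : Type*} [Field k] [AddCommGroup V] [Module k V] {𝒱 : ZMod 2 → Submodule k V}
  {G : Subgroup (V ≃ₗ[k] V)} (hG : Respects G 𝒱) {a b : ℕ}

theorem inclLeft_apply_castAdd (v : Fin a → V) (i : Fin a) :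
    inclLeft k V a b v (Fin.castAdd b i) = v i := by simp [inclLeft]

theorem inclLeft_apply_natAdd (v : Fin a → V) (i : Fin b) :
    inclLeft k V a b v (Fin.natAdd a i) = 0 := by simp [inclLeft]

theorem inclRight_apply_castAdd (v : Fin b → V) (i : Fin a) :
    inclRight k V a b v (Fin.castAdd b i) = 0 := by simp [inclRight]

theorem inclRight_apply_natAdd (v : Fin b → V) (i : Fin b) :
    inclRight k V a b v (Fin.natAdd a i) = v i := by simp [inclRight]

theorem mu_apply (x : SymPow 𝒱 a) (y : SymPow 𝒱 b) :
    mu 𝒱 a b x y = superMap 1 (inclLeft k V a b) (inclLeft_mem 𝒱 a b) x *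
      superMap 1 (inclRight k V a b) (inclRight_mem 𝒱 a b) y := rfl

theorem blockPerm_inv (α : Equiv.Perm (Fin a)) (β : Equiv.Perm (Fin b)) :
    (blockPerm α β)⁻¹ = blockPerm α⁻¹ β⁻¹ := by
  rw [inv_eq_iff_mul_eq_one]
  refine perm_ext_blocks ?_ ?_ <;> simp

theorem mu_permAct (α : Equiv.Perm (Fin a)) (β : Equiv.Perm (Fin b)) (x : SymPow 𝒱 a)
    (y : SymPow 𝒱 b) :
    mu 𝒱 a b (permAct 𝒱 α x) (permAct 𝒱 β y) = permAct 𝒱 (blockPerm α β) (mu 𝒱 a b x y) := by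
  rw [mu_apply, mu_apply, map_mul]
  congr 1
  · refine (superMap_superMap _ _ _ _ (inclLeft k V a b ∘ₗ permMap α)
      (fun i v hv => inclLeft_mem 𝒱 a b i _ (permMap_mem 𝒱 α i v hv)) (fun v => rfl) x).trans
      (superMap_superMap _ _ _ _ _ _ (fun v => ?_) x).symm
    ext l
    simp only [permMap, LinearMap.comp_apply, LinearMap.funLeft_apply, blockPerm_inv]
    refine Fin.addCases (fun i => ?_) (fun i => ?_) l
    · rw [blockPerm_castAdd, inclLeft_apply_castAdd, inclLeft_apply_castAdd]
      rfl
    · rw [blockPerm_natAdd, inclLeft_apply_natAdd, inclLeft_apply_natAdd]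
  · refine (superMap_superMap _ _ _ _ (inclRight k V a b ∘ₗ permMap β)
      (fun i v hv => inclRight_mem 𝒱 a b i _ (permMap_mem 𝒱 β i v hv)) (fun v => rfl) y).trans
      (superMap_superMap _ _ _ _ _ _ (fun v => ?_) y).symm
    ext l
    simp only [permMap, LinearMap.comp_apply, LinearMap.funLeft_apply, blockPerm_inv]
    refine Fin.addCases (fun i => ?_) (fun i => ?_) l
    · rw [blockPerm_castAdd, inclRight_apply_castAdd, inclRight_apply_castAdd]
    · rw [blockPerm_natAdd, inclRight_apply_natAdd, inclRight_apply_natAdd]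
      rfl

theorem shuffle_apply (χ : (n : ℕ) → Equiv.Perm (Fin n) →* ℤˣ) (x : SymPow 𝒱 a)
    (y : SymPow 𝒱 b) : shuffle 𝒱 χ a b x y =
      ∑ τ ∈ shuffles a b, ((χ (a + b) τ : ℤ) : k) • permAct 𝒱 τ (mu 𝒱 a b x y) := by
  simp [shuffle, permAct, LinearMap.sum_apply]

/-- The shuffle product of symmetrized elements is the symmetrization of their concatenation
product, because shuffles represent the cosets of the Young subgroup. -/
theorem shuffle_symmetrize {χ : (n : ℕ) → Equiv.Perm (Fin n) →* ℤˣ}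
    (hχ : ∀ (α : Equiv.Perm (Fin a)) (β : Equiv.Perm (Fin b)),
      χ (a + b) (blockPerm α β) = χ a α * χ b β) (x : SymPow 𝒱 a) (y : SymPow 𝒱 b) :
    shuffle 𝒱 χ a b (symmetrize 𝒱 (χ a) x) (symmetrize 𝒱 (χ b) y) =
      symmetrize 𝒱 (χ (a + b)) (mu 𝒱 a b x y) := by
  rw [shuffle_apply, symmetrize_apply _ (mu 𝒱 a b x y), ← sum_shuffles_blockPerm]
  refine Finset.sum_congr rfl fun τ _ => ?_
  simp only [symmetrize_apply, map_sum, map_smul, LinearMap.sum_apply, LinearMap.smul_apply,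
    Finset.smul_sum, mu_permAct, permAct_mul, map_mul, hχ, Units.val_mul, Int.cast_mul, mul_smul]
  rw [Finset.sum_comm]
  refine Finset.sum_congr rfl fun α _ => Finset.sum_congr rfl fun β _ => ?_
  rw [smul_comm ((χ b β : ℤ) : k)]

theorem mu_invMap_tprod (u : Fin a → invariants hG) (w : Fin b → invariants hG) :
    mu 𝒱 a b (invMap hG a (tprod k u)) (invMap hG b (tprod k w)) =
      invMap hG (a + b) (tprod k (Fin.append u w)) := by
  have hl (i : Fin a) (f : SymPM 𝒱) : superMap 1 (inclLeft k V a b) (inclLeft_mem 𝒱 a b)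
      (incl 𝒱 i f) = incl 𝒱 (Fin.castAdd b i) f := by
    refine superMap_superMap _ _ _ _ _ _ (fun v => ?_) f
    ext l
    refine Fin.addCases (fun j => ?_) (fun j => ?_) l
    · simp [inclLeft_apply_castAdd, Pi.single_apply, Fin.ext_iff]
    · rw [inclLeft_apply_natAdd]
      have : Fin.natAdd a j ≠ Fin.castAdd b i := by
        simp only [ne_eq, Fin.ext_iff, Fin.val_natAdd, Fin.val_castAdd]
        omega
      simp [this]
  have hr (i : Fin b) (f : SymPM 𝒱) : superMap 1 (inclRight k V a b) (inclRight_mem 𝒱 a b)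
      (incl 𝒱 i f) = incl 𝒱 (Fin.natAdd a i) f := by
    refine superMap_superMap _ _ _ _ _ _ (fun v => ?_) f
    ext l
    refine Fin.addCases (fun j => ?_) (fun j => ?_) l
    · rw [inclRight_apply_castAdd]
      have : Fin.castAdd b j ≠ Fin.natAdd a i := by
        simp only [ne_eq, Fin.ext_iff, Fin.val_natAdd, Fin.val_castAdd]
        omega
      simp [this]
    · simp [inclRight_apply_natAdd, Pi.single_apply, Fin.ext_iff]
  rw [mu_apply, invMap_tprod, invMap_tprod, invMap_tprod, map_list_prod, map_list_prod,
    List.map_ofFn, List.map_ofFn, List.ofFn_add, List.prod_append]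
  simp only [Function.comp_def, hl, hr, Fin.append_right]
  simp only [← Fin.castAdd.eq_1, Fin.append_left]

end ShuffleProduct

section TensorAlgebraMap

open scoped TensorProduct
open PiTensorProduct

variable {k V : Type*} [Field k] [AddCommGroup V] [Module k V] {𝒱 : ZMod 2 → Submodule k V}
  {G : Subgroup (V ≃ₗ[k] V)} (hG : Respects G 𝒱) (χ : (n : ℕ) → Equiv.Perm (Fin n) →* ℤˣ)

/-- The linear map `T(U) → ⨁_n Sym_± V^n` that sends `u_1 ⊗ ⋯ ⊗ u_n` to the symmetrization
`∑_σ χ(σ) σ(u_1^{(1)} ⋯ u_n^{(n)})`. -/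
def tensorPhi : TensorAlgebra k (invariants hG) →ₗ[k] Total 𝒱 :=
  DirectSum.lmap (fun n => symmetrize 𝒱 (χ n) ∘ₗ invMap hG n) ∘ₗ
    TensorAlgebra.toDirectSum.toLinearMap

theorem tensorPhi_toTensorAlgebra {n : ℕ} (t : ⨂[k]^n (invariants hG)) :
    tensorPhi hG χ (TensorPower.toTensorAlgebra t) =
      DirectSum.lof k ℕ (fun n => SymPow 𝒱 n) n (symmetrize 𝒱 (χ n) (invMap hG n t)) := by
  have : tensorPhi hG χ ∘ₗ TensorPower.toTensorAlgebra =
      DirectSum.lof k ℕ (fun n => SymPow 𝒱 n) n ∘ₗ symmetrize 𝒱 (χ n) ∘ₗ invMap hG n := by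
    ext u
    simp only [tensorPhi, LinearMap.compMultilinearMap_apply, LinearMap.comp_apply,
      TensorPower.toTensorAlgebra_tprod, AlgHom.toLinearMap_apply,
      TensorAlgebra.toDirectSum_tensorPower_tprod, ← DirectSum.lof_eq_of k, DirectSum.lmap_lof]
  exact DFunLike.congr_fun this t

theorem tensorAlgebra_induction_tensorPower {U : Type*} [AddCommMonoid U] [Module k U]
    {C : TensorAlgebra k U → Prop}
    (tprod : ∀ (n : ℕ) (t : ⨂[k]^n U), C (TensorPower.toTensorAlgebra t))
    (add : ∀ x y, C x → C y → C (x + y)) (x : TensorAlgebra k U) : C x := by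
  rw [← TensorAlgebra.ofDirectSum_toDirectSum x]
  induction TensorAlgebra.toDirectSum x using DirectSum.induction_on with
  | zero => simpa using tprod 0 0
  | of n t =>
    have : TensorAlgebra.ofDirectSum (DirectSum.of (fun n => ⨂[k]^n U) n t) =
        TensorPower.toTensorAlgebra t :=
      DirectSum.toAddMonoid_of (fun _ => LinearMap.toAddMonoidHom TensorPower.toTensorAlgebra) n t
    rw [this]
    exact tprod n t
  | add x y hx hy => rw [map_add]; exact add _ _ hx hy

theorem shuffleMul_lof (a b : ℕ) (x : SymPow 𝒱 a) (y : SymPow 𝒱 b) :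
    shuffleMul 𝒱 χ (DirectSum.lof k ℕ (fun n => SymPow 𝒱 n) a x)
      (DirectSum.lof k ℕ (fun n => SymPow 𝒱 n) b y) =
      DirectSum.lof k ℕ (fun n => SymPow 𝒱 n) (a + b) (shuffle 𝒱 χ a b x y) := by
  simp [shuffleMul]

variable {χ} in
theorem tensorPhi_mul
    (hχ : ∀ (a b : ℕ) (α : Equiv.Perm (Fin a)) (β : Equiv.Perm (Fin b)),
      χ (a + b) (blockPerm α β) = χ a α * χ b β) (x y : TensorAlgebra k (invariants hG)) :
    tensorPhi hG χ (x * y) = shuffleMul 𝒱 χ (tensorPhi hG χ x) (tensorPhi hG χ y) := by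
  induction x using tensorAlgebra_induction_tensorPower with
  | add x x' hx hx' => simp only [add_mul, map_add, hx, hx', LinearMap.add_apply]
  | tprod a s =>
  induction y using tensorAlgebra_induction_tensorPower with
  | add y y' hy hy' => simp only [mul_add, map_add, hy, hy']
  | tprod b t =>
  induction s using PiTensorProduct.induction_on with
  | add s s' hs hs' => simp only [map_add, add_mul, hs, hs', LinearMap.add_apply]
  | smul_tprod c u =>
  induction t using PiTensorProduct.induction_on with
  | add t t' ht ht' => simp only [map_add, mul_add, ht, ht']
  | smul_tprod d w =>
  have hmul : TensorPower.toTensorAlgebra (tprod k u) * TensorPower.toTensorAlgebra (tprod k w) =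
      TensorPower.toTensorAlgebra (tprod k (Fin.append u w)) := by
    rw [← TensorPower.toTensorAlgebra_gMul, TensorPower.tprod_mul_tprod]
  simp only [map_smul, smul_mul_assoc, mul_smul_comm, LinearMap.smul_apply, hmul,
    tensorPhi_toTensorAlgebra, shuffleMul_lof, shuffle_symmetrize (hχ a b), mu_invMap_tprod]

theorem tensorPhi_one : tensorPhi hG χ 1 = totalOne 𝒱 := by
  have h1 : (1 : TensorAlgebra k (invariants hG)) =
      TensorPower.toTensorAlgebra (tprod k (Fin.elim0 : Fin 0 → invariants hG)) := by
    simp [TensorAlgebra.tprod_apply]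
  rw [h1, tensorPhi_toTensorAlgebra, invMap_tprod, totalOne, symmetrize_apply]
  simp

variable {χ} {ε : ℤˣ}

theorem tensorPhi_swap
    (hχ : ∀ (n : ℕ) (i j : Fin n), (i : ℕ) + 1 = j → χ n (Equiv.swap i j) = ε)
    {i j : ZMod 2} {a b : invariants hG} (ha : a ∈ invParity hG i) (hb : b ∈ invParity hG j) :
    tensorPhi hG χ (TensorAlgebra.ι k a * TensorAlgebra.ι k b) =
      (((ε : ℤ) : k) * (-1) ^ (i.val * j.val)) •
        tensorPhi hG χ (TensorAlgebra.ι k b * TensorAlgebra.ι k a) := by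
  have htprod (a b : invariants hG) : TensorAlgebra.ι k a * TensorAlgebra.ι k b =
      TensorPower.toTensorAlgebra (tprod k ![a, b]) := by
    simp [TensorAlgebra.tprod_apply]
  have hmem (l : Fin 2) : ![a, b] l ∈ invParity hG (![i, j] l) := by
    fin_cases l <;> assumption
  have hswap := permAct_swap_invMap hG hmem 0
  have hba : (fun l => ![a, b] (Equiv.swap (Fin.castSucc 0) (Fin.succ 0) l)) = ![b, a] := by
    ext1 l
    fin_cases l <;> simp
  rw [hba] at hswap
  have hsym := congrArg (symmetrize 𝒱 (χ 2)) hswap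
  rw [symmetrize_permAct, hχ 2 _ _ (by simp), map_smul] at hsym
  rw [htprod, htprod, tensorPhi_toTensorAlgebra, tensorPhi_toTensorAlgebra, ← map_smul, mul_smul]
  congr 1
  refine Eq.trans ?_ (congrArg (fun z => ((ε : ℤ) : k) • z) hsym)
  exact (unit_smul_unit_smul ε _).symm

/-- `tensorPhi` is compatible with the defining relations of `Sym_± U` or `∧_± U`. -/
theorem tensorPhi_eq_of_quotMap_eq
    (hχ : ∀ (n : ℕ) (i j : Fin n), (i : ℕ) + 1 = j → χ n (Equiv.swap i j) = ε)
    (hχ' : ∀ (a b : ℕ) (α : Equiv.Perm (Fin a)) (β : Equiv.Perm (Fin b)),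
      χ (a + b) (blockPerm α β) = χ a α * χ b β) {x y : TensorAlgebra k (invariants hG)}
    (h : quotMap ε (invParity hG) x = quotMap ε (invParity hG) y) :
    tensorPhi hG χ x = tensorPhi hG χ y := by
  -- by multiplicativity, equality of values under `tensorPhi` is a ring congruence
  let c : RingCon (TensorAlgebra k (invariants hG)) :=
    { r := fun x y => tensorPhi hG χ x = tensorPhi hG χ y
      iseqv := ⟨fun _ => rfl, Eq.symm, Eq.trans⟩
      add' := fun h h' => by rw [map_add, map_add, h, h']
      mul' := fun h h' => by rw [tensorPhi_mul hG hχ', tensorPhi_mul hG hχ', h, h'] }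
  have hle : ringConGen (SuperRel ε (invParity hG)) ≤ c :=
    RingCon.ringConGen_le.2 fun x y (h : SuperRel ε (invParity hG) x y) => by
      obtain ⟨i, j, a, b, ha, hb⟩ := h
      change tensorPhi hG χ _ = tensorPhi hG χ _
      rw [map_smul]
      exact tensorPhi_swap hG hχ ha hb
  exact hle (Quotient.exact h)

variable [Fintype G] [CharZero k]

variable (χ) in
theorem range_tensorPhi (h𝒱 : DirectSum.IsInternal 𝒱) :
    LinearMap.range (tensorPhi hG χ) = wreathSum hG χ := by
  apply le_antisymm
  · rintro _ ⟨x, rfl⟩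
    induction x using tensorAlgebra_induction_tensorPower with
    | add x y hx hy => rw [map_add]; exact add_mem hx hy
    | tprod n t =>
      rw [tensorPhi_toTensorAlgebra]
      exact Submodule.mem_iSup_of_mem n ⟨_, symmetrize_invMap_mem hG (χ n) t, rfl⟩
  · refine iSup_le fun n => ?_
    rintro _ ⟨x, hx, rfl⟩
    obtain ⟨t, rfl⟩ := exists_symmetrize_invMap_eq hG h𝒱 hx
    exact ⟨_, tensorPhi_toTensorAlgebra hG χ t⟩

theorem quotMap_eq_zero_of_tensorPhi_eq_zero (h𝒱 : DirectSum.IsInternal 𝒱)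
    (hχ : ∀ (n : ℕ) (i j : Fin n), (i : ℕ) + 1 = j → χ n (Equiv.swap i j) = ε)
    {x : TensorAlgebra k (invariants hG)} (hx : tensorPhi hG χ x = 0) :
    quotMap ε (invParity hG) x = 0 := by
  have h (n : ℕ) : tensorQuot hG ε n (TensorAlgebra.toDirectSum x n) = 0 :=
    tensorQuot_eq_zero hG ε h𝒱 (hχ n) (DFunLike.congr_fun hx n)
  classical
  rw [← TensorAlgebra.ofDirectSum_toDirectSum x,
    ← DirectSum.sum_support_of (TensorAlgebra.toDirectSum x), map_sum, map_sum]
  refine Finset.sum_eq_zero fun n _ => ?_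
  rw [← h n]
  exact congrArg (quotMap ε (invParity hG)) <|
    DirectSum.toAddMonoid_of (fun _ => LinearMap.toAddMonoidHom TensorPower.toTensorAlgebra) n _

end TensorAlgebraMap

/-! ### Gradings and the isomorphisms -/

section Transport

variable {k A T : Type*} [Field k] [Ring A] [Algebra k A] [AddCommGroup T] [Module k T]

/-- An injective multiplicative map from a graded algebra that respects candidate components with
independent targets transports the algebra structure and the grading to its range, and these targets
are then exactly the images of the components. -/
theorem trigraded_of_injective {grA : ℕ × ℕ × ℕ → Submodule k A} {mul : T →ₗ[k] T →ₗ[k] T} {one : T}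
    {R : Submodule k T} {gr : ℕ × ℕ × ℕ → Submodule k T} (ψ : A →ₗ[k] T)
    (hψ : Function.Injective ψ) (hrange : LinearMap.range ψ = R) (hone : ψ 1 = one)
    (hmul : ∀ x y, ψ (x * y) = mul (ψ x) (ψ y)) (hgrA : ⨆ d, grA d = ⊤)
    (hgrA_one : 1 ∈ grA 0) (hgrA_mul : ∀ d e, ∀ x ∈ grA d, ∀ y ∈ grA e, x * y ∈ grA (d + e))
    (hle : ∀ d, (grA d).map ψ ≤ gr d) (hgr : ∀ d, gr d ≤ R) (hindep : iSupIndep gr) :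
    IsTrigradedAlgebra (LinearMap.mul k A) 1 ⊤ grA ∧ IsTrigradedAlgebra mul one R gr ∧
      ∃ φ : A ≃ₗ[k] R, IsTrigradedIso (LinearMap.mul k A) 1 grA mul one R gr φ := by
  have hsup : ⨆ d, (grA d).map ψ = R := by
    rw [← Submodule.map_iSup, hgrA, Submodule.map_top, hrange]
  have heq : (fun d => (grA d).map ψ) = gr := by
    refine funext fun d => le_antisymm (hle d) ?_
    -- an element of `gr d` lies in the sum of the images, and independence puts it into the `d`-th
    intro x hx
    have hx' : x ∈ (grA d).map ψ ⊔ ⨆ (e) (_ : e ≠ d), (grA e).map ψ := by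
      have h1 : ⨆ e, (grA e).map ψ ≤ (grA d).map ψ ⊔ ⨆ (e) (_ : e ≠ d), (grA e).map ψ :=
        iSup_le fun e => by
          by_cases h : e = d
          · exact h ▸ le_sup_left
          · exact le_sup_of_le_right (le_iSup₂_of_le e h le_rfl)
      exact h1 (hsup ▸ hgr d hx)
    obtain ⟨y, hy, z, hz, rfl⟩ := Submodule.mem_sup.1 hx'
    have hz1 : z ∈ gr d := by simpa using sub_mem hx (hle d hy)
    have hz2 : z ∈ ⨆ (e) (_ : e ≠ d), gr e := (iSup₂_mono fun e _ => hle e) hz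
    rw [Submodule.disjoint_def.1 (hindep d) z hz1 hz2, add_zero]
    exact hy
  subst heq
  refine ⟨?_, ?_, (LinearEquiv.ofInjective ψ hψ).trans (LinearEquiv.ofEq _ _ hrange), ?_⟩
  · refine ⟨fun _ _ _ _ => trivial, trivial, fun x _ y _ z _ => mul_assoc x y z,
      fun x _ => one_mul x, fun x _ => mul_one x, ?_, hgrA, hgrA_one, hgrA_mul⟩
    refine fun d => Submodule.disjoint_def.2 fun x hx hx' => hψ ?_
    rw [map_zero]
    refine Submodule.disjoint_def.1 (hindep d) _ ⟨x, hx, rfl⟩ ?_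
    have := Submodule.mem_map_of_mem (f := ψ) hx'
    simpa only [Submodule.map_iSup] using this
  · subst hrange
    subst hone
    refine ⟨?_, ⟨1, rfl⟩, ?_, ?_, ?_, hindep, hsup, ⟨1, hgrA_one, rfl⟩, ?_⟩
    · rintro _ ⟨x, rfl⟩ _ ⟨y, rfl⟩
      exact ⟨x * y, hmul x y⟩
    · rintro _ ⟨x, rfl⟩ _ ⟨y, rfl⟩ _ ⟨z, rfl⟩
      rw [← hmul, ← hmul, ← hmul, ← hmul, mul_assoc]
    · rintro _ ⟨x, rfl⟩
      rw [← hmul, one_mul]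
    · rintro _ ⟨x, rfl⟩
      rw [← hmul, mul_one]
    · rintro d e _ ⟨x, hx, rfl⟩ _ ⟨y, hy, rfl⟩
      exact ⟨x * y, hgrA_mul d e x hx y hy, hmul x y⟩
  · exact ⟨hone, hmul, fun d => rfl⟩

end Transport

section Tridegree

variable {k V : Type*} [Field k] [AddCommMonoid V] [Module k V] (ε : ℤˣ)
  (𝒱 : ZMod 2 → Submodule k V) (B : ℕ → ℕ → Submodule k V)

theorem one_mem_tridegree : 1 ∈ tridegree ε 𝒱 B 0 :=
  Submodule.subset_span ⟨Fin.elim0, Fin.elim0, Fin.elim0, fun l => l.elim0, rfl, rfl, by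
    exact List.prod_nil.symm⟩

theorem mul_mem_tridegree (d e : ℕ × ℕ × ℕ) {x y : SuperAlg ε 𝒱} (hx : x ∈ tridegree ε 𝒱 B d)
    (hy : y ∈ tridegree ε 𝒱 B e) : x * y ∈ tridegree ε 𝒱 B (d + e) := by
  have h : tridegree ε 𝒱 B d * tridegree ε 𝒱 B e ≤ tridegree ε 𝒱 B (d + e) := by
    rw [tridegree, tridegree, Submodule.span_mul_span, Submodule.span_le]
    rintro _ ⟨_, ⟨u, p, q, hu, hp, hq, rfl⟩, _, ⟨u', p', q', hu', hp', hq', rfl⟩, rfl⟩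
    refine Submodule.subset_span ⟨Fin.append u u', Fin.append p p', Fin.append q q', ?_, ?_, ?_, ?_⟩
    · exact fun l => Fin.addCases (fun i => by simpa using hu i) (fun i => by simpa using hu' i) l
    · exact (Fin.sum_univ_add _).trans (by simp [hp, hp'])
    · exact (Fin.sum_univ_add _).trans (by simp [hq, hq'])
    · have : (fun l => gen ε 𝒱 (Fin.append u u' l)) =
          Fin.append (fun l => gen ε 𝒱 (u l)) fun l => gen ε 𝒱 (u' l) := by
        ext1 l
        refine Fin.addCases (fun i => ?_) (fun i => ?_) l <;> simp
      change _ = (List.ofFn (n := d.1 + e.1) fun l => gen ε 𝒱 (Fin.append u u' l)).prod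
      rw [this, List.ofFn_fin_append, List.prod_append]
  exact h (Submodule.mul_mem_mul hx hy)

end Tridegree

section Grading

open scoped TensorProduct
open PiTensorProduct

variable {k V : Type*} [Field k] [AddCommGroup V] [Module k V] {𝒱 : ZMod 2 → Submodule k V}

theorem isInternal_powGrading (h𝒱 : DirectSum.IsInternal 𝒱) (n : ℕ) :
    DirectSum.IsInternal (powGrading 𝒱 n) := by
  rw [DirectSum.isInternal_submodule_iff_iSupIndep_and_iSup_eq_top]
  constructor
  · refine iSupIndep_of_projections _ (fun e => LinearMap.pi fun l => proj h𝒱 e ∘ₗ LinearMap.proj l)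
      (fun d x hx => ?_) fun d e hde x hx => ?_
    · ext l
      simp [proj_of_mem h𝒱 (hx l trivial)]
    · ext l
      simp [proj_of_mem h𝒱 (hx l trivial), hde.symm]
  · refine eq_top_iff.2 fun v _ => ?_
    have : v = ∑ e, fun l => proj h𝒱 e (v l) := by
      ext l
      simp [sum_proj h𝒱]
    rw [this]
    exact Submodule.sum_mem _ fun e _ =>
      Submodule.mem_iSup_of_mem e fun l _ => proj_mem h𝒱 e (v l)

variable {G : Subgroup (V ≃ₗ[k] V)} (hG : Respects G 𝒱)
  (χ : (n : ℕ) → Equiv.Perm (Fin n) →* ℤˣ)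

theorem wreathTridegree_le (d : ℕ × ℕ × ℕ) : wreathTridegree hG χ d ≤ wreathSum hG χ :=
  (Submodule.map_mono inf_le_left).trans
    (le_iSup (fun n => (wreathInvariants hG n (χ n)).map (DirectSum.lof k ℕ _ n)) d.1)

theorem iSupIndep_wreathTridegree (h𝒱 : DirectSum.IsInternal 𝒱) :
    iSupIndep (wreathTridegree hG χ) := by
  refine iSupIndep_of_projections _ (fun d => DirectSum.lof k ℕ (fun n => SymPow 𝒱 n) d.1 ∘ₗ
    bidegProj (isInternal_powGrading h𝒱 d.1) d.2 ∘ₗ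
      DirectSum.component k ℕ (fun n => SymPow 𝒱 n) d.1) ?_ ?_
  · rintro ⟨n, i, j⟩ _ ⟨x, hx, rfl⟩
    simp [DirectSum.component.lof_self, bidegProj_of_mem _ _ hx.2]
  · rintro ⟨n, i, j⟩ ⟨m, i', j'⟩ hne _ ⟨x, hx, rfl⟩
    by_cases hmn : m = n
    · subst hmn
      have : (i', j') ≠ (i, j) := fun h => hne (by rw [h])
      simp [DirectSum.component.lof_self, bidegProj_of_mem _ _ hx.2, this]
    · simp [DirectSum.component.of, hmn]

theorem invMap_tprod_mem_bideg {n : ℕ} {u : Fin n → invariants hG} {p q : Fin n → ℕ}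
    (hu : ∀ l, u l ∈ invBideg hG (p l) (q l)) :
    invMap hG n (tprod k u) ∈ bideg (powGrading 𝒱 n) (∑ l, p l) (∑ l, q l) := by
  have h {n m : ℕ} (x : Fin n → SymPow 𝒱 m) (p q : Fin n → ℕ)
      (hx : ∀ l, x l ∈ bideg (powGrading 𝒱 m) (p l) (q l)) :
      (List.ofFn x).prod ∈ bideg (powGrading 𝒱 m) (∑ l, p l) (∑ l, q l) := by
    induction n with
    | zero => simpa using one_mem_bideg (powGrading 𝒱 m)
    | succ n ih =>
      rw [List.ofFn_succ, List.prod_cons, Fin.sum_univ_succ, Fin.sum_univ_succ, ← bideg_mul]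
      exact Submodule.mul_mem_mul (hx 0) (ih _ _ _ fun l => hx l.succ)
  rw [invMap_tprod]
  exact h _ p q fun l => superMap_mem_bideg _ _ (hu l)

theorem symmetrize_mem_bideg {n i j : ℕ} (χ : Equiv.Perm (Fin n) →* ℤˣ) {x : SymPow 𝒱 n}
    (hx : x ∈ bideg (powGrading 𝒱 n) i j) :
    symmetrize 𝒱 χ x ∈ bideg (powGrading 𝒱 n) i j := by
  rw [symmetrize_apply]
  exact Submodule.sum_mem _ fun σ _ => Submodule.smul_mem _ _ (superMap_mem_bideg _ _ hx)

variable [Fintype G] [CharZero k]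

theorem iSup_tridegree (ε : ℤˣ) (h𝒱 : DirectSum.IsInternal 𝒱) :
    ⨆ d, tridegree ε (invParity hG) (invBideg hG) d = ⊤ := by
  refine eq_top_iff.2 fun x _ => ?_
  obtain ⟨x, rfl⟩ := quotMap_surjective ε _ x
  induction x using tensorAlgebra_induction_tensorPower with
  | add x y hx hy => rw [map_add]; exact add_mem (hx trivial) (hy trivial)
  | tprod n t =>
    change tensorQuot hG ε n t ∈ _
    have h : (⊤ : Submodule k (⨂[k]^n (invariants hG))) ≤
        (⨆ d, tridegree ε (invParity hG) (invBideg hG) d).comap (tensorQuot hG ε n) := by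
      rw [← span_tprod_homogeneous hG h𝒱 n, Submodule.span_le]
      rintro _ ⟨u, p, q, hu, rfl⟩
      exact Submodule.mem_iSup_of_mem (n, ∑ l, p l, ∑ l, q l) <|
        Submodule.subset_span ⟨u, p, q, hu, rfl, rfl, tensorQuot_tprod hG ε u⟩
    exact h trivial

/-- The superpolynomial (`ε = 1`) or superexterior (`ε = -1`) algebra of `U = (Sym_± V)^G` is
isomorphic to the algebra of `χ`-relative invariants, for every multiplicative family `χ` of
characters with value `ε` on adjacent transpositions. -/
theorem superAlg_trigraded_iso {χ : (n : ℕ) → Equiv.Perm (Fin n) →* ℤˣ} {ε : ℤˣ}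
    (h𝒱 : DirectSum.IsInternal 𝒱)
    (hχ : ∀ (n : ℕ) (i j : Fin n), (i : ℕ) + 1 = j → χ n (Equiv.swap i j) = ε)
    (hχ' : ∀ (a b : ℕ) (α : Equiv.Perm (Fin a)) (β : Equiv.Perm (Fin b)),
      χ (a + b) (blockPerm α β) = χ a α * χ b β) :
    IsTrigradedAlgebra (LinearMap.mul k (SuperAlg ε (invParity hG))) 1 ⊤
        (tridegree ε (invParity hG) (invBideg hG)) ∧
      IsTrigradedAlgebra (shuffleMul 𝒱 χ) (totalOne 𝒱) (wreathSum hG χ) (wreathTridegree hG χ) ∧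
      ∃ φ : SuperAlg ε (invParity hG) ≃ₗ[k] wreathSum hG χ,
        IsTrigradedIso (LinearMap.mul k (SuperAlg ε (invParity hG))) 1
          (tridegree ε (invParity hG) (invBideg hG)) (shuffleMul 𝒱 χ) (totalOne 𝒱)
          (wreathSum hG χ) (wreathTridegree hG χ) φ := by
  let q := (quotMap ε (invParity hG)).toLinearMap
  have hq : Function.Surjective q := quotMap_surjective ε (invParity hG)
  have hker : LinearMap.ker q ≤ LinearMap.ker (tensorPhi hG χ) := fun x hx => by
    have : quotMap ε (invParity hG) x = quotMap ε (invParity hG) 0 := by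
      rw [map_zero]
      exact hx
    rw [LinearMap.mem_ker, tensorPhi_eq_of_quotMap_eq hG hχ hχ' this, map_zero]
  let ψ : SuperAlg ε (invParity hG) →ₗ[k] Total 𝒱 :=
    (LinearMap.ker q).liftQ (tensorPhi hG χ) hker ∘ₗ
      (q.quotKerEquivOfSurjective hq).symm.toLinearMap
  have hψ (x : TensorAlgebra k (invariants hG)) :
      ψ (quotMap ε (invParity hG) x) = tensorPhi hG χ x := by
    have : (q.quotKerEquivOfSurjective hq).symm (q x) = Submodule.Quotient.mk x := by
      rw [LinearEquiv.symm_apply_eq]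
      rfl
    change (LinearMap.ker q).liftQ (tensorPhi hG χ) hker
      ((q.quotKerEquivOfSurjective hq).symm (q x)) = _
    rw [this, Submodule.liftQ_apply]
  refine trigraded_of_injective ψ ?_ ?_ ?_ ?_ (iSup_tridegree hG ε h𝒱) (one_mem_tridegree _ _ _)
    (fun d e x hx y hy => mul_mem_tridegree _ _ _ d e hx hy) ?_ (wreathTridegree_le hG χ)
    (iSupIndep_wreathTridegree hG χ h𝒱)
  · refine (injective_iff_map_eq_zero ψ).2 fun x hx => ?_
    obtain ⟨x, rfl⟩ := quotMap_surjective ε _ x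
    exact quotMap_eq_zero_of_tensorPhi_eq_zero hG h𝒱 hχ ((hψ x).symm.trans hx)
  · rw [← range_tensorPhi hG χ h𝒱]
    refine le_antisymm ?_ ?_
    · rintro _ ⟨x, rfl⟩
      obtain ⟨x, rfl⟩ := quotMap_surjective ε _ x
      exact ⟨x, (hψ x).symm⟩
    · rintro _ ⟨x, rfl⟩
      exact ⟨_, hψ x⟩
  · rw [← map_one (quotMap ε (invParity hG)), hψ, tensorPhi_one]
  · intro x y
    obtain ⟨x, rfl⟩ := quotMap_surjective ε _ x
    obtain ⟨y, rfl⟩ := quotMap_surjective ε _ y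
    rw [← map_mul, hψ, hψ, hψ, tensorPhi_mul hG hχ']
  · rintro ⟨n, i, j⟩
    rw [tridegree, Submodule.map_span, Submodule.span_le]
    rintro _ ⟨_, ⟨u, p, r, hu, hp, hr, rfl⟩, rfl⟩
    have h := tensorPhi_toTensorAlgebra hG χ (tprod k u)
    rw [← hψ] at h
    change ψ (tensorQuot hG ε n (tprod k u)) = _ at h
    rw [tensorQuot_tprod] at h
    refine ⟨_, ⟨symmetrize_invMap_mem hG (χ n) (tprod k u), ?_⟩, h.symm⟩
    simp only at hp hr ⊢
    rw [← hp, ← hr]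
    exact symmetrize_mem_bideg (χ n) (invMap_tprod_mem_bideg hG hu)

end Grading

end SuperShuffle

end

open SuperShuffle

theorem theorem1p3 {k V : Type*} [Field k] [CharZero k] [AddCommGroup V] [Module k V]
    (𝒱 : ZMod 2 → Submodule k V) (h𝒱 : DirectSum.IsInternal 𝒱)
    (G : Subgroup (V ≃ₗ[k] V)) [Finite G] (hG : Respects G 𝒱) :
    -- all four objects are trigraded algebras
    IsTrigradedAlgebra (LinearMap.mul k (SymInv hG)) 1 ⊤ (symTridegree hG) ∧
    IsTrigradedAlgebra (LinearMap.mul k (ExtInv hG)) 1 ⊤ (extTridegree hG) ∧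
    IsTrigradedAlgebra (shuffleMul 𝒱 trivChar) (totalOne 𝒱) (RG hG)
      (wreathTridegree hG trivChar) ∧
    IsTrigradedAlgebra (shuffleMul 𝒱 signChar) (totalOne 𝒱) (RGsgn hG)
      (wreathTridegree hG signChar) ∧
    -- the two isomorphisms
    (∃ φ : SymInv hG ≃ₗ[k] RG hG,
      IsTrigradedIso (LinearMap.mul k (SymInv hG)) 1 (symTridegree hG)
        (shuffleMul 𝒱 trivChar) (totalOne 𝒱) (RG hG) (wreathTridegree hG trivChar) φ) ∧
    (∃ φ : ExtInv hG ≃ₗ[k] RGsgn hG,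
      IsTrigradedIso (LinearMap.mul k (ExtInv hG)) 1 (extTridegree hG)
        (shuffleMul 𝒱 signChar) (totalOne 𝒱) (RGsgn hG) (wreathTridegree hG signChar) φ) := by
  have := Fintype.ofFinite G
  obtain ⟨h1, h2, h3⟩ := superAlg_trigraded_iso hG (χ := trivChar) (ε := 1) h𝒱
    (fun n i j _ => rfl) (fun a b α β => rfl)
  obtain ⟨h4, h5, h6⟩ := superAlg_trigraded_iso hG (χ := signChar) (ε := -1) h𝒱
    (fun n i j hij => Equiv.Perm.sign_swap fun h => by simp [h] at hij)
    (fun a b α β => sign_blockPerm α β)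
  exact ⟨h1, h4, h2, h5, h3, h6⟩
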